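/- **Theorem 1.2.** For integers $n,A\ge 1$ there are unique integers $\delta\ge 1$ and $a_n>a_{n-1}>\cdots>a_\delta$ with $\delta\le n$ and $a_j\ge j$ for every $j$ such that $$A=\binom{a_n}{n}+\binom{a_{n-1}}{n-1}+\cdots+\binom{a_\delta}{\delta}$$ (the $n$-th Macaulay representation of $A$). Put $$A^{-<n>}:=\binom{a_n-1}{n-1}+\cdots+\binom{a_\delta-1}{\delta-1},$$ with the convention that $\binom{a}{b}=0$ whenever $a<b$ or $b=0$. For a subset $S$ of a complex projective space let $\mathrm{span}(S)$ be its projective linear span, with $\dim\varnothing=-1$. Let $n\ge 1$ and $M\ge N\ge 1$ be integers, let $U\subset\mathbb P^n$ be a connected non-empty open subset of complex projective space, and let $f:U\to\mathbb P^M$ be a holomorphic map such that $\dim(\mathrm{span}(f(U)))\ge N$. Then for a general hyperplane $H\subset\mathbb P^n$ such that $H\cap U\ne\varnothing$, $$\dim(\mathrm{span}(f(H\cap U)))\ge N^{-<n>}.$$ Here "general" has the following meaning. Let $\mathcal U$ be the open set of all hyperplanes $H$ with $H\cap U\neq\varnothing$ in the dual projective space $(\mathbb P^n)^*$. Every point of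 $\mathcal U$ has a connected open neighbourhood in $(\mathbb P^n)^*$ in which the set of those $H\in\mathcal U$ that violate the inequality is contained in a proper analytic subset, namely in the zero set of a holomorphic function that does not vanish identically. In particular the inequality holds for all $H$ in a dense open subset of $\mathcal U$. -/

import Mathlib

open scoped LinearAlgebra.Projectivization

/-! ### Macaulay representations -/

/-- `A = C(a_n, n) + C(a_{n-1}, n-1) + ⋯ + C(a_δ, δ)` with `a_n > a_{n-1} > ⋯ > a_δ`,
`1 ≤ δ ≤ n` and `a_j ≥ j` for every `j`: the `n`-th Macaulay representation of `A`.
Only the values `a j` with `δ ≤ j ≤ n` matter. -/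
structure IsMacaulayRep (n A δ : ℕ) (a : ℕ → ℕ) : Prop where
  one_le : 1 ≤ δ
  le : δ ≤ n
  strictMonoOn : StrictMonoOn a (Set.Icc δ n)
  ge : ∀ j ∈ Set.Icc δ n, j ≤ a j
  eq_sum : A = ∑ j ∈ Finset.Icc δ n, (a j).choose j

/-- The binomial coefficient `C(a, b)` with the convention that it is `0` if `a < b` or `b = 0`. -/
def binom (a b : ℕ) : ℕ := if b = 0 then 0 else a.choose b

open Classical in
/-- The operation `A^{-<n>} = C(a_n - 1, n - 1) + ⋯ + C(a_δ - 1, δ - 1)`, where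
`A = C(a_n, n) + ⋯ + C(a_δ, δ)` is the `n`-th Macaulay representation of `A`.
The representation exists for all `n, A ≥ 1` (`exists_isMacaulayRep`) and is unique
(`IsMacaulayRep.unique`); where there is none (`A = 0` or `n = 0`) the value is `0`. -/
noncomputable def macaulayMinus (n A : ℕ) : ℕ :=
  if h : ∃ p : ℕ × (ℕ → ℕ), IsMacaulayRep n A p.1 p.2 then
    ∑ j ∈ Finset.Icc h.choose.1 n, binom (h.choose.2 j - 1) (j - 1)
  else 0

theorem IsMacaulayRep.pred {n A δ : ℕ} {a : ℕ → ℕ} (h : IsMacaulayRep (n + 1) A δ a)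
    (hδ : δ ≤ n) :
    IsMacaulayRep n (A - (a (n + 1)).choose (n + 1)) δ a ∧
      A = (A - (a (n + 1)).choose (n + 1)) + (a (n + 1)).choose (n + 1) := by
  have hs := h.eq_sum
  rw [Finset.sum_Icc_succ_top (by omega)] at hs
  refine ⟨⟨h.one_le, hδ, h.strictMonoOn.mono (Set.Icc_subset_Icc_right (by omega)),
    fun j hj => h.ge j ⟨hj.1, hj.2.trans (by omega)⟩, by omega⟩, by omega⟩

theorem IsMacaulayRep.bounds {n A δ : ℕ} {a : ℕ → ℕ} (h : IsMacaulayRep n A δ a) :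
    (a n).choose n ≤ A ∧ A < (a n + 1).choose n := by
  induction n generalizing A with
  | zero => have := h.one_le; have := h.le; omega
  | succ n ih =>
    have hge := h.ge (n + 1) ⟨h.le, le_rfl⟩
    have hpos : 0 < (a (n + 1)).choose n := Nat.choose_pos (by omega)
    rw [Nat.choose_succ_succ']
    rcases Nat.lt_or_ge n δ with hδ | hδ
    · have hd : δ = n + 1 := by have := h.le; omega
      have hs := h.eq_sum
      subst hd
      simp at hs
      omega
    · obtain ⟨h1, h2⟩ := h.pred hδ
      have h3 := (ih h1).2
      have h4 : a n < a (n + 1) := h.strictMonoOn ⟨hδ, by omega⟩ ⟨by omega, le_rfl⟩ (by omega)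
      have h5 : (a n + 1).choose n ≤ (a (n + 1)).choose n := Nat.choose_le_choose n h4
      omega

theorem IsMacaulayRep.unique {n A δ δ' : ℕ} {a a' : ℕ → ℕ} (h : IsMacaulayRep n A δ a)
    (h' : IsMacaulayRep n A δ' a') : δ = δ' ∧ ∀ j ∈ Set.Icc δ n, a j = a' j := by
  induction n generalizing A with
  | zero => have := h.one_le; have := h.le; omega
  | succ n ih =>
    have key : a (n + 1) = a' (n + 1) := by
      have b := h.bounds
      have b' := h'.bounds
      by_contra hne
      rcases Nat.lt_or_gt_of_ne hne with hlt | hlt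
      · have := Nat.choose_le_choose (n + 1) (Nat.succ_le_of_lt hlt)
        simp only [Nat.succ_eq_add_one] at this
        omega
      · have := Nat.choose_le_choose (n + 1) (Nat.succ_le_of_lt hlt)
        simp only [Nat.succ_eq_add_one] at this
        omega
    have top : ∀ {B ε : ℕ} {b : ℕ → ℕ}, IsMacaulayRep (n + 1) B ε b → n < ε →
        ε = n + 1 ∧ B = (b (n + 1)).choose (n + 1) := by
      intro B ε b hb hε
      have hd : ε = n + 1 := by have := hb.le; omega
      have hs := hb.eq_sum
      subst hd
      simp at hs
      exact ⟨rfl, hs⟩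
    have low : ∀ {B ε : ℕ} {b : ℕ → ℕ}, IsMacaulayRep (n + 1) B ε b → ε ≤ n →
        (b (n + 1)).choose (n + 1) < B := by
      intro B ε b hb hε
      obtain ⟨h1, h2⟩ := hb.pred hε
      have h3 := h1.bounds.1
      have h4 : 0 < (b n).choose n := Nat.choose_pos (h1.ge n ⟨hε, le_rfl⟩)
      omega
    rcases Nat.lt_or_ge n δ with hδ | hδ <;> rcases Nat.lt_or_ge n δ' with hδ' | hδ'
    · have t := top h hδ
      have t' := top h' hδ'
      refine ⟨by omega, fun j hj => ?_⟩
      have : j = n + 1 := by have := hj.1; have := hj.2; omega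
      rw [this, key]
    · have t := top h hδ
      have t' := low h' hδ'
      rw [← key] at t'
      omega
    · have t := low h hδ
      have t' := top h' hδ'
      rw [← key] at t'
      omega
    · have p := (h.pred hδ).1
      have p' := (h'.pred hδ').1
      rw [← key] at p'
      obtain ⟨e1, e2⟩ := ih p p'
      refine ⟨e1, fun j hj => ?_⟩
      rcases Nat.lt_or_ge n j with hj' | hj'
      · have : j = n + 1 := by have := hj.2; omega
        rw [this, key]
      · exact e2 j ⟨hj.1, hj'⟩

theorem exists_isMacaulayRep {n A : ℕ} (hn : 1 ≤ n) (hA : 1 ≤ A) :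
    ∃ (δ : ℕ) (a : ℕ → ℕ), IsMacaulayRep n A δ a := by
  induction n, hn using Nat.le_induction generalizing A with
  | base =>
    refine ⟨1, fun _ => A, le_rfl, le_rfl, ?_, ?_, by simp⟩
    · intro i hi j hj hij
      have := hi.1; have := hj.2
      omega
    · intro j hj
      exact hj.2.trans hA
  | succ n hn ih =>
    have hex : ∃ a, A < (a + 1).choose (n + 1) := by
      refine ⟨A + n, ?_⟩
      have h1 : (A + n + 1).choose (n + 1) = (A + n + 1).choose A := by
        exact Nat.choose_symm_of_eq_add (by omega)
      have h2 := Nat.choose_le_choose (n + 1) (show A + n ≤ A + n + 1 by omega)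
      have h3 : A < (A + 1).choose 1 := by simp
      have h4 : (A + 1).choose 1 = (A + 1).choose A := by
        exact Nat.choose_symm_of_eq_add (by omega)
      have h5 : (A + 1).choose A ≤ (A + n + 1).choose A := Nat.choose_le_choose A (by omega)
      omega
    classical
    obtain ⟨m, hm, hmin⟩ : ∃ m, A < (m + 1).choose (n + 1) ∧ ∀ k < m,
        (k + 1).choose (n + 1) ≤ A :=
      ⟨Nat.find hex, Nat.find_spec hex, fun k hk => not_lt.mp (Nat.find_min hex hk)⟩
    have hmge : n + 1 ≤ m := by
      by_contra hlt
      have h1 : (m + 1).choose (n + 1) ≤ (n + 1).choose (n + 1) :=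
        Nat.choose_le_choose _ (by omega)
      rw [Nat.choose_self] at h1
      omega
    have hle : m.choose (n + 1) ≤ A := by
      have := hmin (m - 1) (by omega)
      rwa [Nat.sub_add_cancel (by omega)] at this
    rcases Nat.eq_zero_or_pos (A - m.choose (n + 1)) with h0 | hpos
    · refine ⟨n + 1, fun _ => m, by omega, le_rfl, ?_, ?_, ?_⟩
      · intro i hi j hj hij
        have := hi.1; have := hj.2
        omega
      · intro j hj
        exact hj.2.trans hmge
      · simp
        omega
    · obtain ⟨δ, a, h⟩ := ih hpos
      have hδ := h.le
      have hlt : a n < m := by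
        have b := h.bounds.1
        rw [Nat.choose_succ_succ'] at hm
        by_contra hge
        have := Nat.choose_le_choose n (not_lt.mp hge)
        omega
      have hne : ∀ j ≤ n, Function.update a (n + 1) m j = a j := fun j hj =>
        Function.update_of_ne (by omega) _ _
      refine ⟨δ, Function.update a (n + 1) m, h.one_le, by omega, ?_, ?_, ?_⟩
      · intro i hi j hj hij
        have hi2 : i ≤ n := by have := hj.2; omega
        rw [hne i hi2]
        rcases Nat.lt_or_ge n j with hj' | hj'
        · have : j = n + 1 := by have := hj.2; omega
          rw [this, Function.update_self]
          exact lt_of_le_of_lt (h.strictMonoOn.monotoneOn ⟨hi.1, hi2⟩ ⟨hδ, le_rfl⟩ hi2) hlt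
        · rw [hne j hj']
          exact h.strictMonoOn ⟨hi.1, hi2⟩ ⟨hj.1, hj'⟩ hij
      · intro j hj
        rcases Nat.lt_or_ge n j with hj' | hj'
        · have : j = n + 1 := by have := hj.2; omega
          rw [this, Function.update_self]
          exact hmge
        · rw [hne j hj']
          exact h.ge j ⟨hj.1, hj'⟩
      · rw [Finset.sum_Icc_succ_top (by omega), Function.update_self]
        have : ∑ j ∈ Finset.Icc δ n, (Function.update a (n + 1) m j).choose j =
            ∑ j ∈ Finset.Icc δ n, (a j).choose j :=
          Finset.sum_congr rfl fun j hj => by rw [hne j (Finset.mem_Icc.mp hj).2]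
        rw [this, ← h.eq_sum]
        omega

/-- The value of `A^{-<n>}` may be read off from the Macaulay representation. -/
theorem IsMacaulayRep.macaulayMinus_eq {n A δ : ℕ} {a : ℕ → ℕ} (h : IsMacaulayRep n A δ a) :
    macaulayMinus n A = ∑ j ∈ Finset.Icc δ n, binom (a j - 1) (j - 1) := by
  have hex : ∃ p : ℕ × (ℕ → ℕ), IsMacaulayRep n A p.1 p.2 := ⟨(δ, a), h⟩
  rw [macaulayMinus, dif_pos hex]
  obtain ⟨e1, e2⟩ := h.unique hex.choose_spec
  rw [← e1]
  exact Finset.sum_congr rfl fun j hj => by rw [e2 j (Finset.mem_Icc.mp hj)]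

/-! ### Complex projective space -/

/-- The complex projective space `P^n`, with homogeneous coordinates indexed by `0, …, n`. -/
abbrev CPn (n : ℕ) : Type := ℙ ℂ (Fin (n + 1) → ℂ)

/-- The usual topology of `P^n`: the quotient topology from `ℂ^{n+1} ∖ {0}`. -/
instance CPn.instTopologicalSpace (n : ℕ) : TopologicalSpace (CPn n) :=
  inferInstanceAs (TopologicalSpace
    (Quotient (projectivizationSetoid ℂ (Fin (n + 1) → ℂ))))

/-- The dimension of a projective linear subspace; the empty subspace has dimension `-1`. -/
noncomputable def projDim {n : ℕ} (S : Projectivization.Subspace ℂ (Fin (n + 1) → ℂ)) : ℤ :=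
  (Module.finrank ℂ (Projectivization.Subspace.submodule S) : ℤ) - 1

/-- The hyperplane `{[z_0 : ⋯ : z_n] | h_0 z_0 + ⋯ + h_n z_n = 0}` of `P^n` given by the point
`h = [h_0 : ⋯ : h_n]` of the dual projective space, which parametrizes all hyperplanes. -/
def hyperplane {n : ℕ} (h : CPn n) : Set (CPn n) := {x | Projectivization.orthogonal h x}

/-- `f` is holomorphic on `U ⊆ P^n` as a map to `P^M`: near every point of `U` it has the form
`[z] ↦ [F_0(z) : ⋯ : F_M(z)]` with functions `F_j` that are holomorphic in the homogeneous
coordinates and have no common zero.  (Values of `f` outside `U` are irrelevant if `U` is open.) -/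
def IsHolomorphicOn {n M : ℕ} (f : CPn n → CPn M) (U : Set (CPn n)) : Prop :=
  ∀ (v : Fin (n + 1) → ℂ) (hv : v ≠ 0), Projectivization.mk ℂ v hv ∈ U →
    ∃ (O : Set (Fin (n + 1) → ℂ)) (F : (Fin (n + 1) → ℂ) → (Fin (M + 1) → ℂ)),
      IsOpen O ∧ v ∈ O ∧ AnalyticOnNhd ℂ F O ∧
      ∀ w ∈ O, ∀ hw : w ≠ 0, ∃ hF : F w ≠ 0,
        f (Projectivization.mk ℂ w hw) = Projectivization.mk ℂ (F w) hF

/-- Near every point of `D ⊆ P^n`, the set `E` is contained in a proper analytic subset, namely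
in the zero set of a holomorphic function (of the homogeneous coordinates, on a connected open
set) that does not vanish identically. -/
def IsLocallyAnalyticallyThin {n : ℕ} (D E : Set (CPn n)) : Prop :=
  ∀ (v : Fin (n + 1) → ℂ) (hv : v ≠ 0), Projectivization.mk ℂ v hv ∈ D →
    ∃ (O : Set (Fin (n + 1) → ℂ)) (g : (Fin (n + 1) → ℂ) → ℂ),
      IsOpen O ∧ IsConnected O ∧ v ∈ O ∧ AnalyticOnNhd ℂ g O ∧ (∃ w ∈ O, g w ≠ 0) ∧
      ∀ w ∈ O, ∀ hw : w ≠ 0, Projectivization.mk ℂ w hw ∈ E → g w = 0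

/-- The property `Q` holds for a general hyperplane `H` such that `H ∩ U ≠ ∅`: in the space of
all hyperplanes that meet `U`, the exceptional ones lie locally in a proper analytic subset.
(In particular `Q` holds on a dense open set of hyperplanes meeting `U`, if `U` is open.) -/
def ForGeneralHyperplaneMeeting {n : ℕ} (U : Set (CPn n)) (Q : Set (CPn n) → Prop) : Prop :=
  IsLocallyAnalyticallyThin {h | (hyperplane h ∩ U).Nonempty}
    {h | (hyperplane h ∩ U).Nonempty ∧ ¬ Q (hyperplane h)}

open MvPolynomial

/-! ### Ranks of submodules over a domain -/

/-! Near a point `z` of a hyperplane meeting `U`, lift `f` to an analytic `F` and compose with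
linear forms. As `U` is connected, the identity theorem embeds the dual of the linear span of `f(U)`
into the germs at `z`, giving at least `N + 1` independent germs. They can be chosen with linearly
independent leading forms (`exists_leadingForms`). Rescaling at `z` makes the germs on nearby
hyperplanes converge to their leading forms on affine hyperplanes (`exists_det_ne_zero_near`). So it
suffices to bound the rank of a space of polynomials on a generic affine hyperplane; a nonzero
determinant of values then gives the analytic function that catches all bad hyperplanes.

The polynomial statement is an inhomogeneous form of Green's restriction theorem. It is proved
together with a Macaulay-type growth bound, by induction on the number of variables, over polynomial
rings in the parameters of the hyperplanes. Let `ℓ` be the generic equation.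

Growth (`growthBound_succ`): if `Q` contains `P` and all `x_i P`, it contains `ℓ P` once the
parameters are adjoined. Hence `rank Q` is at least `rank P` plus the rank of `Q` on the hyperplane,
and Pascal's rule applies.

Restriction (`restrictionBound_of_growthBound`): let `B_k` be the restriction of `{q | ℓ^k q ∈ W}`;
the ranks of the `B_k` add up to that of `W`. Differentiating `ℓ^(k+1) q ∈ W` in the parameters of
`ℓ`, which do not occur in `W`, shows that `B_k` contains `B_{k+1}` and all `x_i B_{k+1}`. If `B_0`
were too small, the growth bound would force the ranks down so fast that their sum could not reach
`rank W`. -/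

/-- Over a domain, a spanning set of a submodule of rank at least `k` contains `k` linearly
independent elements. -/
theorem exists_linearIndependent_of_le_rank_span {R M : Type} [CommRing R] [IsDomain R]
    [AddCommGroup M] [Module R M] {s : Set M} {k : ℕ}
    (h : (k : Cardinal) ≤ Module.rank R (Submodule.span R s)) :
    ∃ v : Fin k → M, (∀ i, v i ∈ s) ∧ LinearIndependent R v := by
  obtain ⟨t, ht, hmax⟩ := exists_maximal_linearIndepOn R ((↑) : s → M)
  set u : Set M := (↑) '' t with hu
  have hui : LinearIndepOn R id u := ht.id_image
  have hus : u ⊆ s := by rintro _ ⟨x, _, rfl⟩; exact x.2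
  have hle : Submodule.span R u ≤ Submodule.span R s := Submodule.span_mono hus
  -- By maximality the quotient of the two spans is torsion, so it does not contribute to the rank.
  have htors : ∀ x ∈ Submodule.span R s, ∃ a : R, a ≠ 0 ∧ a • x ∈ Submodule.span R u := by
    intro x hx
    induction hx using Submodule.span_induction with
    | mem x hx =>
      by_cases hxt : (⟨x, hx⟩ : s) ∈ t
      · exact ⟨1, one_ne_zero, by
          rw [one_smul]; exact Submodule.subset_span ⟨⟨x, hx⟩, hxt, rfl⟩⟩
      · exact hmax ⟨x, hx⟩ hxt
    | zero => exact ⟨1, one_ne_zero, by simp⟩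
    | add x y _ _ hx hy =>
      obtain ⟨a, ha, hax⟩ := hx
      obtain ⟨b, hb, hby⟩ := hy
      refine ⟨a * b, mul_ne_zero ha hb, ?_⟩
      rw [smul_add, mul_smul a b y, mul_comm a b, mul_smul b a x]
      exact add_mem (Submodule.smul_mem _ _ hax) (Submodule.smul_mem _ _ hby)
    | smul c x _ hx =>
      obtain ⟨a, ha, hax⟩ := hx
      refine ⟨a, ha, ?_⟩
      rw [smul_comm]
      exact Submodule.smul_mem _ _ hax
  have hrank : Module.rank R (Submodule.span R s) = Module.rank R (Submodule.span R u) := by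
    have h0 : Module.rank R (Submodule.span R s ⧸
        (Submodule.span R u).submoduleOf (Submodule.span R s)) = 0 := by
      rw [rank_eq_zero_iff]
      intro x
      obtain ⟨y, rfl⟩ := Submodule.Quotient.mk_surjective _ x
      obtain ⟨a, ha, hay⟩ := htors y y.2
      refine ⟨a, ha, ?_⟩
      rw [← Submodule.Quotient.mk_smul, Submodule.Quotient.mk_eq_zero]
      exact hay
    rw [← rank_quotient_add_rank_of_isDomain
      ((Submodule.span R u).submoduleOf (Submodule.span R s)), h0, zero_add]
    exact (Submodule.submoduleOfEquivOfLe hle).rank_eq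
  rw [hrank, rank_span_set hui] at h
  rw [← Cardinal.mk_fin k] at h
  obtain ⟨e⟩ := h
  refine ⟨fun i => e i, fun i => hus (e i).2, ?_⟩
  exact LinearIndependent.comp hui e e.injective

/-- Adding up the rank of the image and that of a submodule of the kernel. -/
theorem rank_add_rank_map_le {R M M' : Type} [CommRing R] [IsDomain R]
    [AddCommGroup M] [Module R M] [AddCommGroup M'] [Module R M'] (g : M →ₗ[R] M')
    {P Q : Submodule R M} (hQP : Q ≤ P) (hQ : ∀ q ∈ Q, g q = 0) :
    Module.rank R Q + Module.rank R (P.map g) ≤ Module.rank R P := by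
  rw [← (g.domRestrict P).rank_range_add_rank_ker, add_comm, LinearMap.range_domRestrict]
  gcongr
  rw [← (Submodule.submoduleOfEquivOfLe hQP).rank_eq]
  refine Submodule.rank_mono fun x hx => ?_
  exact hQ _ hx

/-- Adding up the rank of the image and that of the kernel. -/
theorem rank_add_rank_map_eq {R M M' : Type} [CommRing R] [IsDomain R]
    [AddCommGroup M] [Module R M] [AddCommGroup M'] [Module R M'] (g : M →ₗ[R] M')
    {P Q : Submodule R M} (hQ : ∀ q, q ∈ Q ↔ q ∈ P ∧ g q = 0) :
    Module.rank R Q + Module.rank R (P.map g) = Module.rank R P := by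
  have hQP : Q ≤ P := fun q hq => ((hQ q).1 hq).1
  rw [← (g.domRestrict P).rank_range_add_rank_ker, add_comm, LinearMap.range_domRestrict]
  congr 1
  rw [← (Submodule.submoduleOfEquivOfLe hQP).rank_eq]
  have : Q.submoduleOf P = LinearMap.ker (g.domRestrict P) := by
    ext x
    simp [Submodule.submoduleOf, hQ]
  rw [this]

/-- The rank of a submodule is bounded from below by its linearly independent families. -/
theorem le_rank_submodule_iff {R M : Type} [CommRing R] [Nontrivial R] [AddCommGroup M]
    [Module R M] {W : Submodule R M} {k : ℕ} :
    (k : Cardinal) ≤ Module.rank R W ↔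
      ∃ v : Fin k → M, (∀ i, v i ∈ W) ∧ LinearIndependent R v := by
  rw [Module.le_rank_iff]
  constructor
  · rintro ⟨v, hv⟩
    exact ⟨fun i => v i, fun i => (v i).2, hv.map' W.subtype (Submodule.ker_subtype W)⟩
  · rintro ⟨v, hv, hli⟩
    exact ⟨fun i => ⟨v i, hv i⟩, LinearIndependent.of_comp W.subtype hli⟩

/-! ### Numerical preparations -/

/-- The shape of a Macaulay representation `∑ C(a_j, j)` over `δ ≤ j ≤ m`; the empty sum
`δ = m + 1` is admitted. -/
structure IsCascade (δ m : ℕ) (a : ℕ → ℕ) : Prop where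
  one_le : 1 ≤ δ
  le : δ ≤ m + 1
  strictMonoOn : StrictMonoOn a (Set.Icc δ m)
  ge : ∀ j ∈ Set.Icc δ m, j ≤ a j

namespace IsCascade

/-- Restriction lowers both entries of a binomial coefficient. A term of index 1 would get index 0
and is dropped, hence the `max`. -/
theorem shift {δ m : ℕ} {a : ℕ → ℕ} (h : IsCascade δ (m + 1) a) :
    IsCascade (max (δ - 1) 1) m fun i => a (i + 1) - 1 := by
  have h1 := h.one_le
  have h2 := h.le
  refine ⟨le_max_right _ _, by omega, ?_, ?_⟩
  · intro i hi j hj hij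
    simp only [Set.mem_Icc] at hi hj
    have h3 : a (i + 1) < a (j + 1) := h.strictMonoOn ⟨by omega, by omega⟩
      ⟨by omega, by omega⟩ (by omega)
    have h4 := h.ge (i + 1) ⟨by omega, by omega⟩
    change a (i + 1) - 1 < a (j + 1) - 1
    omega
  · intro j hj
    simp only [Set.mem_Icc] at hj
    have h4 := h.ge (j + 1) ⟨by omega, by omega⟩
    omega

theorem sum_shift {δ m : ℕ} (h1 : 1 ≤ δ) (g : ℕ → ℕ) :
    ∑ j ∈ Finset.Icc δ (m + 1), g j =
      (if δ = 1 then g 1 else 0) + ∑ i ∈ Finset.Icc (max (δ - 1) 1) m, g (i + 1) := by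
  have key : ∀ d, ∑ i ∈ Finset.Icc d m, g (i + 1) = ∑ j ∈ Finset.Icc (d + 1) (m + 1), g j := by
    intro d
    rw [← Finset.map_add_right_Icc, Finset.sum_map]
    rfl
  rw [key]
  by_cases hδ : δ = 1
  · subst hδ
    simp only [if_true]
    rw [← Finset.add_sum_Ioc_eq_sum_Icc (by omega)]
    rfl
  · rw [if_neg hδ, zero_add]
    congr 2
    omega

/-- Lowering all entries by one kills exactly the terms with `c j = j`, which form an initial
segment. Each is worth `1` and its loss raises the lower index by `1`, so sum plus lower index is
unchanged. -/
theorem exists_pred {δ m : ℕ} {c : ℕ → ℕ} (h : IsCascade δ m c) :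
    ∃ δ', δ ≤ δ' ∧ IsCascade δ' m (fun i => c i - 1) ∧
      ∑ j ∈ Finset.Icc δ m, (c j).choose j + δ =
        ∑ j ∈ Finset.Icc δ' m, (c j - 1 + 1).choose j + δ' := by
  obtain ⟨d, hd⟩ : ∃ d, d + δ = m + 1 := ⟨m + 1 - δ, by have := h.le; omega⟩
  induction d generalizing δ with
  | zero =>
    refine ⟨δ, le_rfl, ⟨h.one_le, h.le, fun i hi => ?_, fun i hi => ?_⟩, ?_⟩
    · have := hi.1; have := hi.2; omega
    · have := hi.1; have := hi.2; omega
    · rw [Finset.Icc_eq_empty (by omega)]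
      rfl
  | succ d ih =>
    have hδ := h.ge δ ⟨le_rfl, by omega⟩
    rcases hδ.eq_or_lt with heq | hlt
    · have h' : IsCascade (δ + 1) m c := ⟨by omega, by omega,
        h.strictMonoOn.mono (Set.Icc_subset_Icc_left (by omega)),
        fun j hj => h.ge j ⟨by have := hj.1; omega, hj.2⟩⟩
      obtain ⟨δ', h1, h2, h3⟩ := ih h' (by omega)
      refine ⟨δ', by omega, h2, ?_⟩
      rw [← h3, ← Finset.add_sum_Ioc_eq_sum_Icc (by omega), ← heq, Nat.choose_self]
      have : Finset.Ioc δ m = Finset.Icc (δ + 1) m := by ext; simp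
      rw [this]
      ring
    · have hgt : ∀ j, δ ≤ j → j ≤ m → j < c j := by
        intro j hj
        induction j, hj using Nat.le_induction with
        | base => exact fun _ => hlt
        | succ j hj ih' =>
          intro hjm
          have := ih' (by omega)
          have : c j < c (j + 1) :=
            h.strictMonoOn ⟨hj, by omega⟩ ⟨by omega, hjm⟩ (by omega)
          omega
      refine ⟨δ, le_rfl, ⟨h.one_le, h.le, fun i hi j hj hij => ?_, fun j hj => ?_⟩, ?_⟩
      · have := h.strictMonoOn hi hj hij
        have := hgt i hi.1 hi.2
        omega
      · have := hgt j hj.1 hj.2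
        omega
      · congr 1
        refine Finset.sum_congr rfl fun j hj => ?_
        have := Finset.mem_Icc.1 hj
        have := hgt j this.1 this.2
        rw [Nat.sub_add_cancel (by omega)]

/-- Hockey-stick summation by Pascal's rule. Truncated subtraction is harmless since `C(0, i) = 0`
for `i ≥ 1`. -/
theorem sum_choose_sub_le {i : ℕ} (hi : 1 ≤ i) (c K : ℕ) :
    ∑ k ∈ Finset.range K, (c - k).choose i ≤ (c + 1).choose (i + 1) := by
  induction K generalizing c with
  | zero => simp
  | succ K ih =>
    rw [Finset.sum_range_succ', Nat.sub_zero]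
    have h1 : ∑ k ∈ Finset.range K, (c - (k + 1)).choose i ≤ (c - 1 + 1).choose (i + 1) := by
      refine le_trans (le_of_eq (Finset.sum_congr rfl fun k _ => ?_)) (ih (c - 1))
      congr 1
      omega
    rcases Nat.eq_zero_or_pos c with rfl | hc
    · have : (0 - 1 + 1).choose (i + 1) = 0 := Nat.choose_eq_zero_of_lt (by omega)
      have : Nat.choose 0 i = 0 := Nat.choose_eq_zero_of_lt (by omega)
      omega
    · rw [Nat.sub_add_cancel hc] at h1
      rw [Nat.choose_succ_succ' c i]
      omega

end IsCascade

/-! ### Restriction to the generic hyperplane, axiomatically -/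

/-- The formal properties of restriction to a generic hyperplane: `poly m n` is thought of as the
ring of polynomials in coordinates `x_0, …, x_{n-1}` over the ring `coeff m` generated by
parameters `p_{j, i}` with `m ≤ j`, and `hyp m = x_m - (p_{m,0} x_0 + ⋯ + p_{m,m-1} x_{m-1} + p_{m,m})`
is the equation of the generic hyperplane. -/
structure HyperplaneTower (S : Type) [CommRing S] [Algebra ℂ S] where
  coeff : ℕ → Subalgebra ℂ S
  poly : ℕ → ℕ → Subalgebra ℂ S
  coord : ℕ → S
  hyp : ℕ → S
  restr : ℕ → S →ₐ[ℂ] S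
  deriv : ℕ → ℕ → Derivation ℂ S S
  coeff_le (m n : ℕ) : coeff m ≤ poly m n
  coeff_anti (m : ℕ) : coeff (m + 1) ≤ coeff m
  poly_anti (m n : ℕ) : poly (m + 1) n ≤ poly m n
  restr_coord {m i : ℕ} : i < m → restr m (coord i) = coord i
  restr_coeff {m : ℕ} {p : S} : p ∈ coeff m → restr m p = p
  restr_mem {m : ℕ} {p : S} : p ∈ poly m (m + 1) → restr m p ∈ poly m m
  restr_eq_zero_iff {m : ℕ} {p : S} : restr m p = 0 ↔ hyp m ∣ p
  hyp_ne_zero (m : ℕ) : hyp m ≠ 0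
  not_isUnit_hyp (m : ℕ) : ¬ IsUnit (hyp m)
  exists_hyp_eq (m : ℕ) : ∃ c : ℕ → S, (∀ i, c i ∈ coeff m) ∧
    hyp m = coord m - (∑ i ∈ Finset.range m, c i * coord i + c m)
  mem_of_hyp_mul_mem {m : ℕ} {p : S} : hyp m * p ∈ poly m (m + 1) → p ∈ poly m (m + 1)
  deriv_mem {m i : ℕ} {p : S} : p ∈ coeff m → deriv m i p ∈ coeff m
  deriv_eq_zero {m n i : ℕ} {p : S} : p ∈ poly (m + 1) n → deriv m i p = 0
  deriv_hyp_self (m : ℕ) : deriv m m (hyp m) = -1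
  deriv_hyp {m i : ℕ} : i < m → deriv m i (hyp m) = -coord i
  independent {m n k : ℕ} {v : Fin k → S} : (∀ i, v i ∈ poly (m + 1) n) →
    LinearIndependent (coeff (m + 1)) v → LinearIndependent (coeff m) v

namespace HyperplaneTower

variable {S : Type} [CommRing S] [Algebra ℂ S] (D : HyperplaneTower S)

theorem smul_eq_mul {m : ℕ} (r : D.coeff m) (p : S) : r • p = (r : S) * p := rfl

/-- Restriction to the generic hyperplane as a linear map over the parameters. -/
def restrₗ (m : ℕ) : S →ₗ[D.coeff m] S where
  toFun := D.restr m
  map_add' := map_add _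
  map_smul' r p := by
    rw [smul_eq_mul, map_mul, D.restr_coeff r.2]
    rfl

@[simp]
theorem restrₗ_apply (m : ℕ) (p : S) : D.restrₗ m p = D.restr m p := rfl

/-- Multiplication by an element as a linear map over the parameters. -/
def mulₗ (m : ℕ) (q : S) : S →ₗ[D.coeff m] S := LinearMap.mulLeft (D.coeff m) q

@[simp]
theorem mulₗ_apply (m : ℕ) (q p : S) : D.mulₗ m q p = q * p := rfl

theorem rank_map_mulₗ [IsDomain S] {m : ℕ} {q : S} (hq : q ≠ 0) (W : Submodule (D.coeff m) S) :
    Module.rank (D.coeff m) (W.map (D.mulₗ m q)) = Module.rank (D.coeff m) W :=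
  (Submodule.equivMapOfInjective (D.mulₗ m q)
    (fun _ _ h => mul_left_cancel₀ hq h) W).symm.rank_eq

variable {D}

/-- Adjoining the parameters `p_{m, i}` to the coefficients. -/
def extend {m : ℕ} (W : Submodule (D.coeff (m + 1)) S) : Submodule (D.coeff m) S :=
  Submodule.span (D.coeff m) W

theorem mem_extend {m : ℕ} {W : Submodule (D.coeff (m + 1)) S} {w : S} (h : w ∈ W) :
    w ∈ extend W := Submodule.subset_span h

theorem extend_mono_mul {m : ℕ} {W V : Submodule (D.coeff (m + 1)) S} {q : S}
    (h : ∀ w ∈ W, q * w ∈ V) : ∀ w ∈ extend W, q * w ∈ extend V := fun _ hw =>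
  (Submodule.span_le (p := (extend V).comap (D.mulₗ m q))).2 (fun _ hv => mem_extend (h _ hv)) hw

theorem mem_poly_of_mem_extend {m n : ℕ} {W : Submodule (D.coeff (m + 1)) S}
    (hW : ∀ w ∈ W, w ∈ D.poly (m + 1) n) {w : S} (hw : w ∈ extend W) : w ∈ D.poly m n := by
  induction hw using Submodule.span_induction with
  | mem x hx => exact D.poly_anti m n (hW x hx)
  | zero => exact zero_mem _
  | add x y _ _ hx hy => exact add_mem hx hy
  | smul r x _ hx => exact mul_mem (D.coeff_le m n r.2) hx

theorem le_rank_extend [IsDomain S] {m n k : ℕ} {W : Submodule (D.coeff (m + 1)) S}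
    (hW : ∀ w ∈ W, w ∈ D.poly (m + 1) n)
    (h : (k : Cardinal) ≤ Module.rank (D.coeff (m + 1)) W) :
    (k : Cardinal) ≤ Module.rank (D.coeff m) (extend W) := by
  rw [le_rank_submodule_iff] at h ⊢
  obtain ⟨v, hv, hli⟩ := h
  exact ⟨v, fun i => mem_extend (hv i), D.independent (fun i => hW _ (hv i)) hli⟩

/-- The larger module is spanned by `W` itself, so independent elements can be picked in `W`;
independence then descends to the smaller coefficient ring. -/
theorem le_rank_of_le_rank_extend [IsDomain S] {m k : ℕ} {W : Submodule (D.coeff (m + 1)) S}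
    (h : (k : Cardinal) ≤ Module.rank (D.coeff m) (extend W)) :
    (k : Cardinal) ≤ Module.rank (D.coeff (m + 1)) W := by
  obtain ⟨v, hv, hli⟩ := exists_linearIndependent_of_le_rank_span h
  rw [le_rank_submodule_iff]
  refine ⟨v, hv, ?_⟩
  rw [linearIndependent_iff'] at hli ⊢
  intro I r hr i hi
  have key := hli I (fun j => ⟨r j, D.coeff_anti m (r j).2⟩) hr i hi
  rw [Subtype.ext_iff, ZeroMemClass.coe_zero] at key ⊢
  exact key

/-- The derivation kills `W`, so it acts only on the coefficients of a combination of elements of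
`W`. -/
theorem deriv_mem_extend {m n i : ℕ} {W : Submodule (D.coeff (m + 1)) S}
    (hW : ∀ w ∈ W, w ∈ D.poly (m + 1) n) {w : S} (hw : w ∈ extend W) :
    D.deriv m i w ∈ extend W := by
  induction hw using Submodule.span_induction with
  | mem x hx =>
    rw [D.deriv_eq_zero (hW x hx)]
    exact zero_mem _
  | zero => rw [map_zero]; exact zero_mem _
  | add x y _ _ hx hy => rw [map_add]; exact add_mem hx hy
  | smul r x hx' hx =>
    rw [smul_eq_mul, Derivation.leibniz]
    refine add_mem (Submodule.smul_mem _ r hx) ?_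
    have := Submodule.smul_mem _ (⟨_, D.deriv_mem (i := i) r.2⟩ : D.coeff m) hx'
    rw [smul_eq_mul] at this
    rw [_root_.smul_eq_mul, mul_comm]
    exact this

variable (D)

/-- The lower bound for the rank of a space of polynomials in `x_0, …, x_{m-1}` that contains
a given space and its products with the coordinates. -/
def GrowthBound (m : ℕ) : Prop :=
  ∀ (P Q : Submodule (D.coeff m) S) (δ : ℕ) (a : ℕ → ℕ), IsCascade δ m a →
    (∀ p ∈ P, p ∈ D.poly m m) → P ≤ Q → (∀ i < m, ∀ p ∈ P, D.coord i * p ∈ Q) →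
    ((∑ j ∈ Finset.Icc δ m, (a j).choose j + 1 : ℕ) : Cardinal) ≤ Module.rank (D.coeff m) P →
    ((∑ j ∈ Finset.Icc δ m, (a j + 1).choose j + δ : ℕ) : Cardinal) ≤ Module.rank (D.coeff m) Q

/-- The lower bound for the rank of the restriction of a space of polynomials in `x_0, …, x_m`
to the generic hyperplane. -/
def RestrictionBound (m : ℕ) : Prop :=
  ∀ (W : Submodule (D.coeff (m + 1)) S) (δ : ℕ) (a : ℕ → ℕ), IsCascade δ (m + 1) a →
    (∀ w ∈ W, w ∈ D.poly (m + 1) (m + 1)) →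
    ((∑ j ∈ Finset.Icc δ (m + 1), (a j).choose j + 1 : ℕ) : Cardinal) ≤
      Module.rank (D.coeff (m + 1)) W →
    ((∑ j ∈ Finset.Icc δ (m + 1), binom (a j - 1) (j - 1) + 1 : ℕ) : Cardinal) ≤
      Module.rank (D.coeff m) ((extend W).map (D.restrₗ m))

end HyperplaneTower

theorem IsCascade.sum_binom {δ m : ℕ} {a : ℕ → ℕ} (h : IsCascade δ (m + 1) a) :
    ∑ j ∈ Finset.Icc δ (m + 1), binom (a j - 1) (j - 1) =
      ∑ i ∈ Finset.Icc (max (δ - 1) 1) m, (a (i + 1) - 1).choose i := by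
  rw [IsCascade.sum_shift h.one_le]
  have h0 : binom (a 1 - 1) (1 - 1) = 0 := by simp [binom]
  rw [h0, ite_self, zero_add]
  refine Finset.sum_congr rfl fun i hi => ?_
  have := (Finset.mem_Icc.1 hi).1
  rw [Nat.add_sub_cancel, binom, if_neg (by omega)]

/-! ### Growth and restriction bounds by simultaneous induction -/

namespace HyperplaneTower

variable {S : Type} [CommRing S] [Algebra ℂ S] (D : HyperplaneTower S) [IsDomain S]

omit [IsDomain S] in
theorem growthBound_zero : D.GrowthBound 0 := by
  intro P Q δ a ha _ hPQ _ h
  have h1 := ha.one_le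
  have h2 := ha.le
  rw [Finset.Icc_eq_empty (by omega), Finset.sum_empty] at h ⊢
  obtain rfl : δ = 1 := by omega
  exact h.trans (Submodule.rank_mono hPQ)

/-- In `extend Q`, the multiples `hyp k * p` lie in the kernel of restriction and contribute the
rank of `P`. The image contributes the growth bound in one variable less, applied to the restriction
of `P`. -/
theorem growthBound_succ {k : ℕ} (hR : D.RestrictionBound k) (hG : D.GrowthBound k) :
    D.GrowthBound (k + 1) := by
  intro P Q δ a ha hP hPQ hmul h
  have h1 := hR P δ a ha hP h
  rw [ha.sum_binom] at h1
  have h2 := hG ((extend P).map (D.restrₗ k)) ((extend Q).map (D.restrₗ k)) _ _ ha.shift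
    (by
      rintro _ ⟨p, hp, rfl⟩
      exact D.restr_mem (mem_poly_of_mem_extend hP hp))
    (Submodule.map_mono (Submodule.span_mono hPQ))
    (by
      rintro i hi _ ⟨p, hp, rfl⟩
      refine ⟨D.coord i * p, extend_mono_mul (hmul i (by omega)) p hp, ?_⟩
      rw [restrₗ_apply, map_mul, D.restr_coord hi, restrₗ_apply]) h1
  have h3 : (extend P).map (D.mulₗ k (D.hyp k)) ≤ extend Q := by
    rintro _ ⟨p, hp, rfl⟩
    obtain ⟨c, hc, hh⟩ := D.exists_hyp_eq k
    have hco : ∀ i < k + 1, D.coord i * p ∈ extend Q := fun i hi =>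
      extend_mono_mul (hmul i hi) p hp
    have hcm : ∀ i, ∀ q ∈ extend Q, c i * q ∈ extend Q := fun i q hq =>
      Submodule.smul_mem _ (⟨c i, hc i⟩ : D.coeff k) hq
    rw [mulₗ_apply, hh, sub_mul, add_mul, Finset.sum_mul]
    refine sub_mem (hco k (by omega)) (add_mem (sum_mem fun i hi => ?_) ?_)
    · rw [mul_assoc]
      exact hcm i _ (hco i (by have := Finset.mem_range.1 hi; omega))
    · exact hcm k p (Submodule.span_mono hPQ hp)
  have h4 := rank_add_rank_map_le (D.restrₗ k) h3 (by
    rintro _ ⟨p, _, rfl⟩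
    exact D.restr_eq_zero_iff.2 (dvd_mul_right _ _))
  rw [D.rank_map_mulₗ (D.hyp_ne_zero k)] at h4
  have h5 := le_rank_extend hP h
  apply le_rank_of_le_rank_extend
  refine le_trans ?_ ((add_le_add h5 h2).trans h4)
  rw [← Nat.cast_add, Nat.cast_le]
  have h6 := ha.one_le
  rw [IsCascade.sum_shift h6 (fun j => (a j).choose j),
    IsCascade.sum_shift h6 (fun j => (a j + 1).choose j)]
  have h7 : ∑ i ∈ Finset.Icc (max (δ - 1) 1) k, (a (i + 1) + 1).choose (i + 1) =
      ∑ i ∈ Finset.Icc (max (δ - 1) 1) k, (a (i + 1) - 1 + 1).choose i +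
        ∑ i ∈ Finset.Icc (max (δ - 1) 1) k, (a (i + 1)).choose (i + 1) := by
    rw [← Finset.sum_add_distrib]
    refine Finset.sum_congr rfl fun i hi => ?_
    have hi := Finset.mem_Icc.1 hi
    have := ha.ge (i + 1) ⟨by omega, by omega⟩
    rw [Nat.sub_add_cancel (by omega), Nat.choose_succ_succ']
  rw [h7]
  -- For `δ = 1` the unshifted term grows from `a 1` to `a 1 + 1`, paid for by the spare `1` in the
  -- bound for `P`. Otherwise the constants `1` and `δ - 1` add up to `δ`.
  split_ifs with hδ
  · simp only [Nat.choose_one_right]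
    omega
  · omega

/-- The elements whose product with the `k`-th power of the equation lies in `W`. -/
def quot {m : ℕ} (W : Submodule (D.coeff m) S) (k : ℕ) : Submodule (D.coeff m) S :=
  W.comap (D.mulₗ m (D.hyp m ^ k))

variable {D}

omit [IsDomain S] in
theorem mem_quot {m k : ℕ} {W : Submodule (D.coeff m) S} {q : S} :
    q ∈ D.quot W k ↔ D.hyp m ^ k * q ∈ W := Iff.rfl

omit [IsDomain S] in
theorem mem_poly_of_mem_quot {m k : ℕ} {W : Submodule (D.coeff m) S}
    (hW : ∀ w ∈ W, w ∈ D.poly m (m + 1)) {q : S} (hq : q ∈ D.quot W k) :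
    q ∈ D.poly m (m + 1) := by
  have := hW _ (mem_quot.1 hq)
  clear hq
  induction k with
  | zero => simpa using this
  | succ k ih => exact ih (D.mem_of_hyp_mul_mem (by rwa [← mul_assoc, ← pow_succ']))

/-- Rank-nullity: the kernel of restriction on one step of the filtration is the equation times the
next step. -/
theorem rank_quot {m : ℕ} (W : Submodule (D.coeff m) S) (k : ℕ) :
    Module.rank (D.coeff m) (D.quot W (k + 1)) +
      Module.rank (D.coeff m) ((D.quot W k).map (D.restrₗ m)) =
      Module.rank (D.coeff m) (D.quot W k) := by
  rw [← D.rank_map_mulₗ (D.hyp_ne_zero m) (D.quot W (k + 1))]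
  apply rank_add_rank_map_eq
  intro q
  rw [restrₗ_apply, D.restr_eq_zero_iff]
  constructor
  · rintro ⟨p, hp, rfl⟩
    refine ⟨?_, dvd_mul_right _ _⟩
    rw [mulₗ_apply, mem_quot, ← mul_assoc, ← pow_succ]
    exact hp
  · rintro ⟨hq, p, rfl⟩
    refine ⟨p, ?_, rfl⟩
    rw [mem_quot, ← mul_assoc, ← pow_succ] at hq
    exact hq

-- The derivative of `hyp^(k+1) * q` stays in `extend W`. Dividing it by `(k+1) * hyp^k` leaves
-- `∂hyp * q` plus a multiple of `hyp`, which vanishes on the hyperplane. Characteristic zero enters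
-- through `(k+1)⁻¹`.
omit [IsDomain S] in
theorem restr_deriv_hyp_mul_mem {m n k i : ℕ} {W : Submodule (D.coeff (m + 1)) S}
    (hW : ∀ w ∈ W, w ∈ D.poly (m + 1) n) {q : S} (hq : q ∈ D.quot (extend W) (k + 1)) :
    D.restr m (D.deriv m i (D.hyp m)) * D.restr m q ∈
      (D.quot (extend W) k).map (D.restrₗ m) := by
  have h1 := deriv_mem_extend (i := i) hW (mem_quot.1 hq)
  set c : D.coeff m := algebraMap ℂ (D.coeff m) (k + 1)⁻¹ with hc
  have hcc : (c : S) * (k + 1) = 1 := by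
    have : (c : S) = algebraMap ℂ S (k + 1)⁻¹ := rfl
    have h2 : ((k : S) + 1) = algebraMap ℂ S (k + 1) := by simp
    rw [this, h2, ← map_mul, inv_mul_cancel₀ (Nat.cast_add_one_ne_zero k), map_one]
  have h2 : (D.deriv m i (D.hyp m) * q + c * D.hyp m * D.deriv m i q) ∈ D.quot (extend W) k := by
    rw [mem_quot]
    have h3 := Submodule.smul_mem _ c h1
    rw [smul_eq_mul, Derivation.leibniz, Derivation.leibniz_pow] at h3
    simp only [_root_.smul_eq_mul, nsmul_eq_mul, Nat.add_sub_cancel, Nat.cast_add,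
      Nat.cast_one] at h3
    convert h3 using 1
    linear_combination (-D.hyp m ^ k * D.deriv m i (D.hyp m) * q) * hcc
  refine ⟨_, h2, ?_⟩
  rw [restrₗ_apply, map_add, map_mul, map_mul, map_mul, D.restr_eq_zero_iff.2 dvd_rfl, mul_zero,
    zero_mul, add_zero]

-- Differentiation in the constant term of the equation, where `∂hyp = -1`; the slopes, with `∂hyp =
-- -coord i`, give the companion statement below.
omit [IsDomain S] in
theorem map_quot_succ_le {m n k : ℕ} {W : Submodule (D.coeff (m + 1)) S}
    (hW : ∀ w ∈ W, w ∈ D.poly (m + 1) n) :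
    (D.quot (extend W) (k + 1)).map (D.restrₗ m) ≤ (D.quot (extend W) k).map (D.restrₗ m) := by
  rintro _ ⟨q, hq, rfl⟩
  have := restr_deriv_hyp_mul_mem (i := m) hW hq
  rw [D.deriv_hyp_self, map_neg, map_one, neg_one_mul] at this
  simpa using neg_mem this

omit [IsDomain S] in
theorem coord_mul_mem_map_quot {m n k i : ℕ} (hi : i < m) {W : Submodule (D.coeff (m + 1)) S}
    (hW : ∀ w ∈ W, w ∈ D.poly (m + 1) n) :
    ∀ b ∈ (D.quot (extend W) (k + 1)).map (D.restrₗ m),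
      D.coord i * b ∈ (D.quot (extend W) k).map (D.restrₗ m) := by
  rintro _ ⟨q, hq, rfl⟩
  have := restr_deriv_hyp_mul_mem (i := i) hW hq
  rw [D.deriv_hyp hi, map_neg, D.restr_coord hi, neg_mul] at this
  simpa using neg_mem this

omit [IsDomain S] in
theorem quot_zero {m : ℕ} (W : Submodule (D.coeff m) S) : D.quot W 0 = W := by
  ext q
  rw [mem_quot, pow_zero, one_mul]

theorem rank_le_sum_of_rank_map_quot_le {m : ℕ} {W : Submodule (D.coeff m) S} {b : ℕ → ℕ}
    (h : ∀ k, Module.rank (D.coeff m) ((D.quot W k).map (D.restrₗ m)) ≤ (b k : Cardinal)) (K : ℕ) :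
    Module.rank (D.coeff m) W ≤
      ((∑ k ∈ Finset.range K, b k : ℕ) : Cardinal) + Module.rank (D.coeff m) (D.quot W K) := by
  induction K with
  | zero => rw [quot_zero]; simp
  | succ K ih =>
    refine ih.trans ?_
    rw [← rank_quot, Finset.sum_range_succ, Nat.cast_add, add_assoc, add_comm (Module.rank _ _)]
    gcongr
    exact h K

/-- If all later restrictions vanish, an element can be divided by the equation indefinitely, which
is impossible for a nonzero element and a non-unit. -/
theorem quot_eq_bot [WfDvdMonoid S] {m K : ℕ} {W : Submodule (D.coeff m) S}
    (h : ∀ k, K ≤ k → Module.rank (D.coeff m) ((D.quot W k).map (D.restrₗ m)) = 0) :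
    D.quot W K = ⊥ := by
  rw [eq_bot_iff]
  intro q hq
  have hdvd : ∀ j, ∃ p ∈ D.quot W (K + j), q = D.hyp m ^ j * p := by
    intro j
    induction j with
    | zero => exact ⟨q, hq, by simp⟩
    | succ j ih =>
      obtain ⟨p, hp, rfl⟩ := ih
      have h1 := h (K + j) (by omega)
      rw [Submodule.rank_eq_zero] at h1
      have h2 : D.restr m p ∈ (D.quot W (K + j)).map (D.restrₗ m) := ⟨p, hp, rfl⟩
      rw [h1, Submodule.mem_bot, D.restr_eq_zero_iff] at h2
      obtain ⟨r, rfl⟩ := h2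
      refine ⟨r, ?_, by ring⟩
      rw [mem_quot] at hp ⊢
      rwa [← mul_assoc, ← pow_succ] at hp
  by_contra hq0
  have hfin := FiniteMultiplicity.of_not_isUnit (D.not_isUnit_hyp m) hq0
  obtain ⟨n, hn⟩ := hfin
  obtain ⟨p, _, hp⟩ := hdvd (n + 1)
  exact hn ⟨p, hp⟩

theorem restrictionBound_of_growthBound [WfDvdMonoid S] {m : ℕ} (hG : D.GrowthBound m) :
    D.RestrictionBound m := by
  intro W δ a ha hW h
  by_contra hlt
  set B : ℕ → Submodule (D.coeff m) S := fun k => (D.quot (extend W) k).map (D.restrₗ m) with hB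
  have hWp : ∀ w ∈ extend W, w ∈ D.poly m (m + 1) := fun w hw => mem_poly_of_mem_extend hW hw
  have hnot : ∀ {k : ℕ} {c : Cardinal}, ¬ ((k + 1 : ℕ) : Cardinal) ≤ c → c ≤ (k : Cardinal) := by
    intro k c hc
    rw [Nat.cast_succ, Cardinal.natCast_add_one_le_iff, not_lt] at hc
    exact hc
  -- Here `c i = a (i + 1) - 1`, so the negated claim bounds the rank of `B 0` by a cascade sum.
  obtain ⟨c, δ₀, hc, hδ₀, hsum⟩ : ∃ c δ₀, IsCascade δ₀ m c ∧
      Module.rank (D.coeff m) (B 0) ≤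
        ((∑ i ∈ Finset.Icc δ₀ m, (c i).choose i : ℕ) : Cardinal) ∧
      ∑ i ∈ Finset.Icc δ₀ m, (c i + 1).choose (i + 1) ≤
        ∑ j ∈ Finset.Icc δ (m + 1), (a j).choose j := by
    refine ⟨_, _, ha.shift, ?_, ?_⟩
    · rw [← ha.sum_binom]
      have := hnot hlt
      rwa [← quot_zero (extend W)] at this
    · rw [IsCascade.sum_shift ha.one_le]
      refine le_trans (Finset.sum_le_sum fun i hi => ?_) (Nat.le_add_left _ _)
      have hi := Finset.mem_Icc.1 hi
      have h1 := ha.one_le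
      have := ha.ge (i + 1) ⟨by omega, by omega⟩
      rw [Nat.sub_add_cancel (by omega)]
  -- The growth bound read backwards: if `B (k + 1)` exceeded its bound, then by the invariance in
  -- `exists_pred` the rank of `B k` would exceed its own by at least `δ' ≥ 1`.
  have hk : ∀ k, ∃ δ', δ₀ ≤ δ' ∧ IsCascade δ' m (fun i => c i - k) ∧
      Module.rank (D.coeff m) (B k) ≤
        ((∑ i ∈ Finset.Icc δ' m, (c i - k).choose i : ℕ) : Cardinal) := by
    intro k
    induction k with
    | zero => exact ⟨δ₀, le_rfl, hc, hδ₀⟩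
    | succ k ih =>
      obtain ⟨δ', h1, h2, h3⟩ := ih
      obtain ⟨δ'', h4, h5, h6⟩ := h2.exists_pred
      refine ⟨δ'', h1.trans h4, h5, hnot fun h7 => ?_⟩
      have h8 := hG (B (k + 1)) (B k) δ'' _ h5
        (by
          rintro _ ⟨q, hq, rfl⟩
          exact D.restr_mem (mem_poly_of_mem_quot hWp hq))
        (map_quot_succ_le hW) (fun i hi => coord_mul_mem_map_quot hi hW) h7
      have h9 := h8.trans h3
      rw [Nat.cast_le, ← h6] at h9
      have := h2.one_le
      omega
  have hb : ∀ k, Module.rank (D.coeff m) (B k) ≤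
      ((∑ i ∈ Finset.Icc δ₀ m, (c i - k).choose i : ℕ) : Cardinal) := by
    intro k
    obtain ⟨δ', h1, _, h3⟩ := hk k
    refine h3.trans (Nat.cast_le.2 ?_)
    exact Finset.sum_le_sum_of_subset (Finset.Icc_subset_Icc_left h1)
  -- Any common upper bound of the `c i` would do: from `K` on, every `C(c i - k, i)` is zero.
  set K := ∑ i ∈ Finset.Icc δ₀ m, c i with hK
  have hbot : D.quot (extend W) K = ⊥ := by
    refine quot_eq_bot fun k hkK => ?_
    refine le_antisymm ((hb k).trans ?_) zero_le
    rw [Finset.sum_eq_zero, Nat.cast_zero]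
    intro i hi
    have h1 : c i ≤ K := Finset.single_le_sum (f := c) (fun _ _ => Nat.zero_le _) hi
    have h2 := (Finset.mem_Icc.1 hi).1
    have h3 := hc.one_le
    exact Nat.choose_eq_zero_of_lt (by omega)
  have h1 := (le_rank_extend hW h).trans (rank_le_sum_of_rank_map_quot_le hb K)
  rw [hbot, rank_bot, add_zero, Nat.cast_le, Finset.sum_comm] at h1
  have h2 : ∑ i ∈ Finset.Icc δ₀ m, ∑ k ∈ Finset.range K, (c i - k).choose i ≤
      ∑ i ∈ Finset.Icc δ₀ m, (c i + 1).choose (i + 1) := by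
    refine Finset.sum_le_sum fun i hi => IsCascade.sum_choose_sub_le ?_ _ _
    exact hc.one_le.trans (Finset.mem_Icc.1 hi).1
  omega

variable (D) in
theorem growthBound [WfDvdMonoid S] (m : ℕ) : D.GrowthBound m := by
  induction m with
  | zero => exact D.growthBound_zero
  | succ m ih => exact D.growthBound_succ (restrictionBound_of_growthBound ih) ih

variable (D) in
theorem restrictionBound [WfDvdMonoid S] (m : ℕ) : D.RestrictionBound m :=
  restrictionBound_of_growthBound (D.growthBound m)

variable (D) in
/-- Restricting linearly independent elements to the generic hyperplane. -/
theorem exists_linearIndependent_restr [WfDvdMonoid S] {m δ : ℕ} {a : ℕ → ℕ}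
    (ha : IsCascade δ (m + 1) a)
    {g : Fin (∑ j ∈ Finset.Icc δ (m + 1), (a j).choose j + 1) → S}
    (hg : ∀ i, g i ∈ D.poly (m + 1) (m + 1)) (hli : LinearIndependent (D.coeff (m + 1)) g) :
    ∃ J : Fin (∑ j ∈ Finset.Icc δ (m + 1), binom (a j - 1) (j - 1) + 1) →
        Fin (∑ j ∈ Finset.Icc δ (m + 1), (a j).choose j + 1),
      LinearIndependent (D.coeff m) fun i => D.restr m (g (J i)) := by
  set W : Submodule (D.coeff (m + 1)) S := Submodule.span (D.coeff (m + 1)) (Set.range g) with hW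
  have h1 := le_rank_submodule_iff.2
    ⟨g, fun i => Submodule.subset_span (s := Set.range g) ⟨i, rfl⟩, hli⟩
  have hWp : ∀ w ∈ W, w ∈ D.poly (m + 1) (m + 1) := by
    intro w hw
    induction hw using Submodule.span_induction with
    | mem x hx => obtain ⟨i, rfl⟩ := hx; exact hg i
    | zero => exact zero_mem _
    | add x y _ _ hx hy => exact add_mem hx hy
    | smul r x _ hx => exact mul_mem (D.coeff_le _ _ r.2) hx
  have h2 := D.restrictionBound m W δ a ha hWp h1
  have h3 : ∀ w ∈ W,
      w ∈ (Submodule.span (D.coeff m) (Set.range fun i => D.restr m (g i))).comap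
        (D.restrₗ m) := by
    intro w hw
    induction hw using Submodule.span_induction with
    | mem x hx => obtain ⟨i, rfl⟩ := hx; exact Submodule.subset_span ⟨i, rfl⟩
    | zero => exact zero_mem _
    | add x y _ _ hx hy => exact add_mem hx hy
    | smul r x _ hx => exact Submodule.smul_mem _ (⟨r, D.coeff_anti m r.2⟩ : D.coeff m) hx
  have h4 := Submodule.map_le_iff_le_comap.2 (Submodule.span_le.2 h3)
  obtain ⟨v, hv, hvi⟩ :=
    exists_linearIndependent_of_le_rank_span (h2.trans (Submodule.rank_mono h4))
  choose J hJ using hv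
  refine ⟨J, ?_⟩
  have : (fun i => D.restr m (g (J i))) = v := funext hJ
  rwa [this]

end HyperplaneTower

/-! ### The polynomial ring of coordinates and parameters -/

namespace GenericHyperplane

/-- The polynomial ring in coordinates `x_i` and parameters `p_{m, i}`. -/
abbrev Poly : Type := MvPolynomial (ℕ ⊕ ℕ × ℕ) ℂ

/-- The coordinate `x_i`. -/
noncomputable abbrev coord (i : ℕ) : Poly := X (Sum.inl i)

/-- The parameter `p_{m, i}`. -/
noncomputable abbrev param (m i : ℕ) : Poly := X (Sum.inr (m, i))

/-- The parameters `p_{j, i}` with `m ≤ j`. -/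
def paramVars (m : ℕ) : Set (ℕ ⊕ ℕ × ℕ) := {v | ∃ j i, m ≤ j ∧ v = Sum.inr (j, i)}

/-- The parameters `p_{j, i}` with `m ≤ j` and the coordinates `x_i` with `i < n`. -/
def allVars (m n : ℕ) : Set (ℕ ⊕ ℕ × ℕ) := paramVars m ∪ {v | ∃ i < n, v = Sum.inl i}

/-- The ring of polynomials in the parameters `p_{j, i}` with `m ≤ j`. -/
noncomputable abbrev ParamRing (m : ℕ) : Subalgebra ℂ Poly := supported ℂ (paramVars m)

/-- The ring of polynomials in the parameters `p_{j, i}` with `m ≤ j` and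
the coordinates `x_i` with `i < n`. -/
noncomputable abbrev PolyRing (m n : ℕ) : Subalgebra ℂ Poly := supported ℂ (allVars m n)

theorem smul_eq_mul {m : ℕ} (r : ParamRing m) (p : Poly) : r • p = (r : Poly) * p := rfl

theorem param_mem {m j i : ℕ} (h : m ≤ j) : param j i ∈ ParamRing m :=
  (X_mem_supported).2 ⟨j, i, h, rfl⟩

theorem coord_mem {m n i : ℕ} (h : i < n) : coord i ∈ PolyRing m n :=
  (X_mem_supported).2 (Or.inr ⟨i, h, rfl⟩)

theorem paramRing_le {m n k : ℕ} (h : k ≤ m) : ParamRing m ≤ PolyRing k n :=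
  supported_mono fun _ ⟨j, i, hj, hv⟩ => Or.inl ⟨j, i, h.trans hj, hv⟩

theorem paramRing_anti {m k : ℕ} (h : k ≤ m) : ParamRing m ≤ ParamRing k :=
  supported_mono fun _ ⟨j, i, hj, hv⟩ => ⟨j, i, h.trans hj, hv⟩

theorem polyRing_mono {m n k l : ℕ} (h : k ≤ m) (h' : n ≤ l) : PolyRing m n ≤ PolyRing k l :=
  supported_mono <| Set.union_subset_union (fun _ ⟨j, i, hj, hv⟩ => ⟨j, i, h.trans hj, hv⟩)
    fun _ ⟨i, hi, hv⟩ => ⟨i, hi.trans_le h', hv⟩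

/-- An algebra map that fixes the variables in `s` fixes the polynomials in them. -/
theorem aeval_eq_self {σ : Type} {s : Set σ} {g : σ → MvPolynomial σ ℂ}
    (hg : ∀ v ∈ s, g v = X v) {p : MvPolynomial σ ℂ} (hp : p ∈ supported ℂ s) : aeval g p = p := by
  rw [supported_eq_adjoin_X] at hp
  induction hp using Algebra.adjoin_induction with
  | mem x hx => obtain ⟨v, hv, rfl⟩ := hx; rw [aeval_X, hg v hv]
  | algebraMap r => simp
  | add x y _ _ hx hy => rw [map_add, hx, hy]
  | mul x y _ _ hx hy => rw [map_mul, hx, hy]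

/-- An algebra map that sends the variables in `s` to a subalgebra sends the polynomials in
them to this subalgebra. -/
theorem aeval_mem {σ : Type} {s : Set σ} {g : σ → MvPolynomial σ ℂ}
    {B : Subalgebra ℂ (MvPolynomial σ ℂ)}
    (hg : ∀ v ∈ s, g v ∈ B) {p : MvPolynomial σ ℂ} (hp : p ∈ supported ℂ s) : aeval g p ∈ B := by
  rw [supported_eq_adjoin_X] at hp
  induction hp using Algebra.adjoin_induction with
  | mem x hx => obtain ⟨v, hv, rfl⟩ := hx; rw [aeval_X]; exact hg v hv
  | algebraMap r => rw [AlgHom.commutes]; exact B.algebraMap_mem r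
  | add x y _ _ hx hy => rw [map_add]; exact add_mem hx hy
  | mul x y _ _ hx hy => rw [map_mul]; exact mul_mem hx hy

open Classical in
/-- Linear independence persists when new variables are adjoined to the coefficients. -/
theorem linearIndependent_supported {σ ι : Type} {s t u : Set σ} (hu : u ∩ t ⊆ s)
    {w : ι → MvPolynomial σ ℂ} (hw : ∀ i, w i ∈ supported ℂ u)
    (hli : LinearIndependent (supported ℂ s) w) : LinearIndependent (supported ℂ t) w := by
  rw [linearIndependent_iff'] at hli ⊢
  intro I r hr i hi
  apply Subtype.ext
  apply MvPolynomial.funext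
  intro c
  -- Specializing the new variables to the constants `c v` fixes every `w i` and turns a relation
  -- over `t` into one over `s`. Hence each coefficient vanishes at every point `c`.
  set g : σ → MvPolynomial σ ℂ := fun v => if v ∈ t \ s then C (c v) else X v with hg
  have hgu : ∀ v ∈ u, g v = X v := fun v hv => if_neg fun h => h.2 (hu ⟨hv, h.1⟩)
  have hgt : ∀ v ∈ t, g v ∈ supported ℂ s := by
    intro v hv
    by_cases hvs : v ∈ s
    · simp only [hg, Set.mem_sdiff, hvs, not_true, and_false, if_false]
      exact X_mem_supported.2 hvs
    · simp only [hg, Set.mem_sdiff, hvs, hv, not_false_iff, and_self, if_true]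
      exact (supported ℂ s).algebraMap_mem (c v)
  have hev : ∀ p : MvPolynomial σ ℂ, eval c (aeval g p) = eval c p := by
    intro p
    have : ((aeval c : MvPolynomial σ ℂ →ₐ[ℂ] ℂ).comp (aeval g)) = aeval c := by
      apply MvPolynomial.algHom_ext
      intro v
      simp only [hg, AlgHom.comp_apply, aeval_X]
      split_ifs <;> simp
    simpa [aeval_eq_eval] using DFunLike.congr_fun this p
  have key := hli I (fun j => ⟨aeval g (r j : MvPolynomial σ ℂ), aeval_mem hgt (r j).2⟩) (by
    have h1 := congrArg (aeval g) hr
    rw [map_sum, map_zero] at h1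
    rw [← h1]
    refine Finset.sum_congr rfl fun j _ => ?_
    rw [Subalgebra.smul_def, Subalgebra.smul_def, _root_.smul_eq_mul, _root_.smul_eq_mul, map_mul,
      aeval_eq_self hgu (hw j)]) i hi
  have key' := congrArg Subtype.val key
  simp only [ZeroMemClass.coe_zero] at key' ⊢
  rw [← hev, key']


/-! ### The generic hyperplane -/

/-- The linear form `p_{m, 0} x_0 + ⋯ + p_{m, m - 1} x_{m - 1} + p_{m, m}`. -/
noncomputable def linForm (m : ℕ) : Poly :=
  ∑ i ∈ Finset.range m, param m i * coord i + param m m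

/-- The equation of the generic hyperplane. -/
noncomputable def hyp (m : ℕ) : Poly := coord m - linForm m

/-- Restriction to the generic hyperplane, by elimination of `x_m`. -/
noncomputable def restr (m : ℕ) : Poly →ₐ[ℂ] Poly :=
  aeval fun v => if v = Sum.inl m then linForm m else X v

theorem linForm_mem {m n : ℕ} (h : m ≤ n) : linForm m ∈ PolyRing m n := by
  refine add_mem (sum_mem fun i hi => mul_mem ?_ (coord_mem ?_)) ?_
  · exact paramRing_le le_rfl (param_mem le_rfl)
  · exact (Finset.mem_range.1 hi).trans_le h
  · exact paramRing_le le_rfl (param_mem le_rfl)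

theorem hyp_mem (m : ℕ) : hyp m ∈ PolyRing m (m + 1) :=
  sub_mem (coord_mem (Nat.lt_succ_self m)) (linForm_mem (Nat.le_succ m))

theorem restr_eq_self {m k : ℕ} {p : Poly} (hp : p ∈ PolyRing k m) : restr m p = p := by
  refine aeval_eq_self (fun v hv => if_neg ?_) hp
  rintro rfl
  rcases hv with ⟨_, _, _, hv⟩ | ⟨i, hi, hv⟩
  · simp at hv
  · simp only [Sum.inl.injEq] at hv
    omega

theorem restr_coord {m : ℕ} : restr m (coord m) = linForm m := by
  simp [restr]

theorem restr_hyp (m : ℕ) : restr m (hyp m) = 0 := by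
  rw [hyp, map_sub, restr_coord, restr_eq_self (linForm_mem le_rfl), sub_self]

theorem restr_mem {m k : ℕ} (h : k ≤ m) {p : Poly} (hp : p ∈ PolyRing k (m + 1)) :
    restr m p ∈ PolyRing k m := by
  refine aeval_mem (fun v hv => ?_) hp
  by_cases hvm : v = Sum.inl m
  · rw [if_pos hvm]
    exact polyRing_mono h le_rfl (linForm_mem le_rfl)
  · rw [if_neg hvm]
    refine X_mem_supported.2 ?_
    rcases hv with hv | ⟨i, hi, rfl⟩
    · exact Or.inl hv
    · refine Or.inr ⟨i, ?_, rfl⟩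
      have : i ≠ m := fun h => hvm (by rw [h])
      omega

/-- Modulo the equation, `x_m` equals `linForm m`, so restriction is the identity there. -/
theorem hyp_dvd_of_restr_eq_zero {m : ℕ} {p : Poly} (hp : restr m p = 0) : hyp m ∣ p := by
  rw [← Ideal.mem_span_singleton, ← Ideal.Quotient.eq_zero_iff_mem]
  set I := Ideal.span {hyp m}
  have h : (Ideal.Quotient.mkₐ ℂ I).comp (restr m) = Ideal.Quotient.mkₐ ℂ I := by
    apply MvPolynomial.algHom_ext
    intro v
    by_cases hv : v = Sum.inl m
    · subst hv
      rw [AlgHom.comp_apply, restr_coord]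
      refine (Ideal.Quotient.eq.2 ?_).symm
      exact Ideal.mem_span_singleton_self _
    · simp [restr, hv]
  have := DFunLike.congr_fun h p
  rw [AlgHom.comp_apply, hp, map_zero] at this
  exact this.symm

theorem restr_eq_zero_iff {m : ℕ} {p : Poly} : restr m p = 0 ↔ hyp m ∣ p :=
  ⟨hyp_dvd_of_restr_eq_zero, fun ⟨q, hq⟩ => by rw [hq, map_mul, restr_hyp, zero_mul]⟩

theorem hyp_ne_zero (m : ℕ) : hyp m ≠ 0 := by
  intro h
  have h1 : coord m ∈ PolyRing m m := by
    rw [sub_eq_zero.1 h]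
    exact linForm_mem le_rfl
  rw [X_mem_supported] at h1
  rcases h1 with ⟨_, _, _, hv⟩ | ⟨i, hi, hv⟩
  · simp at hv
  · simp only [Sum.inl.injEq] at hv
    omega

theorem not_isUnit_hyp (m : ℕ) : ¬ IsUnit (hyp m) := fun h => by
  have := h.map (restr m)
  rw [restr_hyp] at this
  exact not_isUnit_zero this

/-! ### Derivatives with respect to the parameters -/

theorem pderiv_mem_paramRing {m : ℕ} (v : ℕ ⊕ ℕ × ℕ) {p : Poly} (hp : p ∈ ParamRing m) :
    pderiv v p ∈ ParamRing m := by
  have hp' := hp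
  rw [ParamRing, supported_eq_adjoin_X] at hp'
  induction hp' using Algebra.adjoin_induction with
  | mem x hx =>
    obtain ⟨w, hw, rfl⟩ := hx
    classical
    rw [pderiv_X, Pi.single_apply]
    split_ifs
    · exact one_mem _
    · exact zero_mem _
  | algebraMap r =>
    rw [Derivation.map_algebraMap]
    exact zero_mem _
  | add x y hx hy hx' hy' =>
    rw [← supported_eq_adjoin_X] at hx hy
    rw [map_add]
    exact add_mem (hx' hx) (hy' hy)
  | mul x y hx hy hx' hy' =>
    rw [← supported_eq_adjoin_X] at hx hy
    rw [Derivation.leibniz]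
    exact add_mem (mul_mem hx (hy' hy)) (mul_mem hy (hx' hx))

theorem pderiv_eq_zero_of_mem {m n i : ℕ} {p : Poly} (hp : p ∈ PolyRing (m + 1) n) :
    pderiv (Sum.inr (m, i)) p = 0 := by
  refine pderiv_eq_zero_of_notMem_vars fun h => ?_
  rcases mem_supported.1 hp h with ⟨j, k, hj, hv⟩ | ⟨k, _, hv⟩
  · simp only [Sum.inr.injEq, Prod.mk.injEq] at hv
    omega
  · simp at hv

theorem pderiv_hyp_self (m : ℕ) : pderiv (Sum.inr (m, m)) (hyp m) = -1 := by
  classical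
  rw [hyp, linForm, map_sub, map_add, map_sum, pderiv_X_of_ne (by simp), pderiv_X_self,
    Finset.sum_eq_zero]
  · ring
  · intro i hi
    have hi := Finset.mem_range.1 hi
    rw [Derivation.leibniz, pderiv_X_of_ne (by simp), pderiv_X_of_ne (by simp; omega)]
    simp

theorem pderiv_hyp {m i : ℕ} (hi : i < m) :
    pderiv (Sum.inr (m, i)) (hyp m) = -coord i := by
  classical
  rw [hyp, linForm, map_sub, map_add, map_sum, pderiv_X_of_ne (by simp),
    pderiv_X_of_ne (by simp; omega), Finset.sum_eq_single i]
  · rw [Derivation.leibniz, pderiv_X_of_ne (by simp), pderiv_X_self]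
    simp
  · intro j _ hj
    rw [Derivation.leibniz, pderiv_X_of_ne (by simp), pderiv_X_of_ne (by simpa using hj)]
    simp
  · intro h
    exact absurd (Finset.mem_range.2 hi) h

/-- Setting all foreign variables to zero fixes both the product and `hyp m`; cancellation shows
that it fixes `p`. -/
theorem mem_polyRing_of_hyp_mul_mem {m : ℕ} {p : Poly} (hp : hyp m * p ∈ PolyRing m (m + 1)) :
    p ∈ PolyRing m (m + 1) := by
  classical
  set g : ℕ ⊕ ℕ × ℕ → Poly := fun v => if v ∈ allVars m (m + 1) then X v else 0 with hg
  have hgX : ∀ v ∈ allVars m (m + 1), g v = X v := fun v hv => if_pos hv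
  have hmem : ∀ q : Poly, aeval g q ∈ PolyRing m (m + 1) := by
    intro q
    refine aeval_mem (s := Set.univ) (fun v _ => ?_) (by rw [supported_univ]; trivial)
    by_cases hv : v ∈ allVars m (m + 1)
    · rw [hgX v hv]
      exact X_mem_supported.2 hv
    · rw [hg]
      simp only [hv, if_false]
      exact zero_mem _
  have h := aeval_eq_self hgX hp
  rw [map_mul, aeval_eq_self hgX (hyp_mem m)] at h
  rw [← mul_left_cancel₀ (hyp_ne_zero m) h]
  exact hmem p

/-- Among the variables allowed in `v`, the only parameters are those of `ParamRing m`; any others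
are new variables for `v`. -/
theorem linearIndependent_paramRing {m m' n k : ℕ} {v : Fin k → Poly}
    (hv : ∀ i, v i ∈ PolyRing m n) (h : LinearIndependent (ParamRing m) v) :
    LinearIndependent (ParamRing m') v := by
  have hu : allVars m n ∩ paramVars m' ⊆ paramVars m := by
    rintro x ⟨hx | ⟨i, _, rfl⟩, ⟨_, _, _, hx'⟩⟩
    · exact hx
    · simp at hx'
  exact linearIndependent_supported hu hv h

/-- The generic hyperplanes in polynomial rings. -/
noncomputable def tower : HyperplaneTower Poly where
  coeff := ParamRing
  poly := PolyRing
  coord := coord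
  hyp := hyp
  restr := restr
  deriv m i := pderiv (Sum.inr (m, i))
  coeff_le _ _ := paramRing_le le_rfl
  coeff_anti m := paramRing_anti (Nat.le_succ m)
  poly_anti m _ := polyRing_mono (Nat.le_succ m) le_rfl
  restr_coord h := restr_eq_self (k := 0) (coord_mem h)
  restr_coeff h := restr_eq_self (paramRing_le le_rfl h)
  restr_mem := restr_mem le_rfl
  restr_eq_zero_iff := restr_eq_zero_iff
  hyp_ne_zero := hyp_ne_zero
  not_isUnit_hyp := not_isUnit_hyp
  exists_hyp_eq m := ⟨fun i => param m i, fun _ => param_mem le_rfl, rfl⟩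
  mem_of_hyp_mul_mem := mem_polyRing_of_hyp_mul_mem
  deriv_mem := pderiv_mem_paramRing _
  deriv_eq_zero := pderiv_eq_zero_of_mem
  deriv_hyp_self := pderiv_hyp_self
  deriv_hyp := pderiv_hyp
  independent := linearIndependent_paramRing

end GenericHyperplane

/-! ### From linear independence to nonvanishing determinants of values -/

/-- Linearly independent vectors are told apart by a nonzero determinant of values under
a family of linear forms without common zero. -/
theorem exists_det_ne_zero {R M ι : Type} [CommRing R] [Nontrivial R] [AddCommGroup M] [Module R M]
    (e : ι → M →ₗ[R] R) (he : ∀ x, (∀ y, e y x = 0) → x = 0) {r : ℕ} {g : Fin r → M}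
    (hg : LinearIndependent R g) :
    ∃ y : Fin r → ι, (Matrix.of fun i l => e (y i) (g l)).det ≠ 0 := by
  induction r with
  | zero => exact ⟨Fin.elim0, by simp⟩
  | succ r ih =>
    obtain ⟨y, hy⟩ := ih (hg.comp Fin.succ (Fin.succ_injective r))
    -- These are the cofactors along a first row still to be chosen. Since `c 0 ≠ 0`, the
    -- combination `∑ c j • g j` is nonzero, and a form not vanishing on it supplies that row.
    set c : Fin (r + 1) → R := fun j => (-1) ^ (j : ℕ) *
      (Matrix.of fun i l => e (y i) (g (j.succAbove l))).det with hc
    have hx : ∑ j, c j • g j ≠ 0 := by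
      intro h
      have := Fintype.linearIndependent_iff.1 hg c h 0
      rw [hc] at this
      simp only [Fin.val_zero, pow_zero, one_mul] at this
      exact hy this
    obtain ⟨y₀, hy₀⟩ := not_forall.1 (mt (he _) hx)
    refine ⟨Fin.cons y₀ y, ?_⟩
    rw [Matrix.det_succ_row_zero]
    rw [map_sum] at hy₀
    intro h
    apply hy₀
    rw [← h]
    refine Finset.sum_congr rfl fun j _ => ?_
    rw [map_smul, hc, _root_.smul_eq_mul]
    simp only [Matrix.of_apply, Fin.cons_zero]
    rw [mul_right_comm]
    congr 2

namespace GenericHyperplane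

/-- Evaluation of the coordinates at a point. -/
noncomputable def evalCoord (y : ℕ → ℂ) : Poly →ₐ[ℂ] Poly :=
  aeval (Sum.elim (fun i => C (y i)) fun q => X (Sum.inr q))

theorem evalCoord_mem (y : ℕ → ℂ) (p : Poly) : evalCoord y p ∈ ParamRing 0 := by
  refine aeval_mem (s := Set.univ) (fun v _ => ?_) (by rw [supported_univ]; trivial)
  rcases v with i | ⟨j, i⟩
  · exact (ParamRing 0).algebraMap_mem (y i)
  · exact param_mem (Nat.zero_le j)

/-- Evaluation of the coordinates at a point as a linear map over the parameters. -/
noncomputable def evalCoordₗ (y : ℕ → ℂ) : Poly →ₗ[ParamRing 0] ParamRing 0 where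
  toFun p := ⟨evalCoord y p, evalCoord_mem y p⟩
  map_add' p q := Subtype.ext (map_add _ p q)
  map_smul' r p := by
    apply Subtype.ext
    rw [smul_eq_mul]
    change evalCoord y (r * p) = (r : Poly) * evalCoord y p
    rw [map_mul]
    congr 1
    refine aeval_eq_self (fun v hv => ?_) r.2
    obtain ⟨j, i, _, rfl⟩ := hv
    rfl

theorem eval_evalCoord (c : ℕ ⊕ ℕ × ℕ → ℂ) (y : ℕ → ℂ) (p : Poly) :
    eval c (evalCoord y p) = eval (Sum.elim y (c ∘ Sum.inr)) p := by
  have : (aeval c : Poly →ₐ[ℂ] ℂ).comp (evalCoord y) = aeval (Sum.elim y (c ∘ Sum.inr)) := by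
    apply MvPolynomial.algHom_ext
    rintro (i | q) <;> simp [evalCoord]
  simpa [aeval_eq_eval] using DFunLike.congr_fun this p

theorem evalCoordₗ_injective (p : Poly) (h : ∀ y, evalCoordₗ y p = 0) : p = 0 := by
  apply MvPolynomial.funext
  intro c
  have h1 := congrArg Subtype.val (h (c ∘ Sum.inl))
  change evalCoord (c ∘ Sum.inl) p = 0 at h1
  have h2 := eval_evalCoord c (c ∘ Sum.inl) p
  rw [h1, Sum.elim_comp_inl_inr] at h2
  rw [← h2]

theorem eval_restr (m : ℕ) (c : ℕ ⊕ ℕ × ℕ → ℂ) (p : Poly) :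
    eval c (restr m p) = eval (Function.update c (Sum.inl m)
      (∑ k ∈ Finset.range m, c (Sum.inr (m, k)) * c (Sum.inl k) + c (Sum.inr (m, m)))) p := by
  have : (aeval c : Poly →ₐ[ℂ] ℂ).comp (restr m) = aeval (Function.update c (Sum.inl m)
      (∑ k ∈ Finset.range m, c (Sum.inr (m, k)) * c (Sum.inl k) + c (Sum.inr (m, m)))) := by
    apply MvPolynomial.algHom_ext
    intro v
    by_cases hv : v = Sum.inl m
    · subst hv
      rw [AlgHom.comp_apply, restr_coord, aeval_X, Function.update_self]
      simp [linForm]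
    · simp [restr, hv]
  simpa [aeval_eq_eval] using DFunLike.congr_fun this p

/-- Polynomials in `n` variables as polynomials in the coordinates `x_0, …, x_{n-1}`. -/
noncomputable def embed (n : ℕ) : MvPolynomial (Fin n) ℂ →ₐ[ℂ] Poly :=
  rename fun j : Fin n => Sum.inl (j : ℕ)

theorem embed_injective (n : ℕ) : Function.Injective (embed n) :=
  rename_injective _ fun _ _ h => Fin.ext (Sum.inl_injective h)

theorem embed_mem {n : ℕ} (p : MvPolynomial (Fin n) ℂ) :
    embed n p ∈ supported ℂ (Set.range fun j : Fin n => (Sum.inl (j : ℕ) : ℕ ⊕ ℕ × ℕ)) := by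
  induction p using MvPolynomial.induction_on with
  | C a =>
    rw [embed, rename_C]
    exact (supported ℂ _).algebraMap_mem a
  | add p q hp hq => rw [map_add]; exact add_mem hp hq
  | mul_X p j hp =>
    rw [map_mul, embed, rename_X]
    exact mul_mem hp (X_mem_supported.2 ⟨j, rfl⟩)

theorem embed_mem_polyRing {n m : ℕ} (p : MvPolynomial (Fin n) ℂ) : embed n p ∈ PolyRing m n :=
  supported_mono (by rintro _ ⟨j, rfl⟩; exact Or.inr ⟨j, j.2, rfl⟩) (embed_mem p)

/-- The images contain no parameters, and the polynomials without variables are the constants, so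
independence over `ℂ` suffices. -/
theorem linearIndependent_embed {n k : ℕ} {P : Fin k → MvPolynomial (Fin n) ℂ}
    (hP : LinearIndependent ℂ P) :
    LinearIndependent (ParamRing n) fun i => embed n (P i) := by
  have h1 : LinearIndependent ℂ fun i => embed n (P i) :=
    hP.map_injOn (embed n).toLinearMap (embed_injective n).injOn
  refine linearIndependent_supported (s := ∅) ?_ (fun i => embed_mem (P i)) ?_
  · rintro _ ⟨⟨j, rfl⟩, ⟨_, _, _, h⟩⟩
    simp at h
  · rw [linearIndependent_iff'] at h1 ⊢
    intro I r hr i hi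
    have h2 : ∀ j, ∃ c : ℂ, (r j : Poly) = algebraMap ℂ Poly c := by
      intro j
      obtain ⟨c, hc⟩ := Algebra.mem_bot.1 ((supported_empty (R := ℂ)).le (r j).2)
      exact ⟨c, hc.symm⟩
    choose c hc using h2
    have h3 := h1 I c (by
      rw [← hr]
      refine Finset.sum_congr rfl fun j _ => ?_
      rw [Subalgebra.smul_def, hc, algebraMap_smul]) i hi
    rw [Subtype.ext_iff, ZeroMemClass.coe_zero, hc, h3, map_zero]

/-- Restricting linearly independent polynomials to a generic hyperplane. -/
theorem exists_linearIndependent_restr {m N δ : ℕ} {a : ℕ → ℕ} (ha : IsMacaulayRep (m + 1) N δ a)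
    {P : Fin (N + 1) → MvPolynomial (Fin (m + 1)) ℂ} (hP : LinearIndependent ℂ P) :
    ∃ J : Fin (macaulayMinus (m + 1) N + 1) → Fin (N + 1),
      LinearIndependent (ParamRing m) fun i => restr m (embed (m + 1) (P (J i))) := by
  have hc : IsCascade δ (m + 1) a := ⟨ha.one_le, ha.le.trans (Nat.le_succ _), ha.strictMonoOn, ha.ge⟩
  have hN := ha.eq_sum
  subst hN
  rw [ha.macaulayMinus_eq]
  have h1 : LinearIndependent (tower.coeff (m + 1)) fun i => embed (m + 1) (P i) :=
    linearIndependent_embed hP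
  obtain ⟨J, hJ⟩ := tower.exists_linearIndependent_restr hc
    (fun i => embed_mem_polyRing (P i)) h1
  exact ⟨J, hJ⟩

/-- Independent polynomials remain independent on a general hyperplane, to the extent given by
`macaulayMinus`, as witnessed by a nonzero determinant. -/
theorem exists_det_eval_ne_zero {m N δ : ℕ} {a : ℕ → ℕ} (ha : IsMacaulayRep (m + 1) N δ a)
    {P : Fin (N + 1) → MvPolynomial (Fin (m + 1)) ℂ} (hP : LinearIndependent ℂ P)
    {ε : ℝ} (hε : 0 < ε) :
    ∃ (J : Fin (macaulayMinus (m + 1) N + 1) → Fin (N + 1)) (t : Fin m → ℂ) (s : ℂ)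
      (y : Fin (macaulayMinus (m + 1) N + 1) → Fin m → ℂ), (∀ i, ‖t i‖ < ε) ∧
      (Matrix.of fun i l => eval (Fin.snoc (y i) (∑ k, t k * y i k + s) : Fin (m + 1) → ℂ)
        (P (J l))).det ≠ 0 := by
  obtain ⟨J, hJ⟩ := exists_linearIndependent_restr ha hP
  have h1 : LinearIndependent (ParamRing 0) fun i => restr m (embed (m + 1) (P (J i))) :=
    linearIndependent_paramRing (n := m)
      (fun i => restr_mem le_rfl (embed_mem_polyRing _)) hJ
  obtain ⟨y, hy⟩ := exists_det_ne_zero evalCoordₗ evalCoordₗ_injective h1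
  set A : Matrix (Fin (macaulayMinus (m + 1) N + 1)) (Fin (macaulayMinus (m + 1) N + 1))
    (ParamRing 0) := Matrix.of fun i l => evalCoordₗ (y i) (restr m (embed (m + 1) (P (J l))))
    with hA
  have h2 : (A.det : Poly) ≠ 0 := fun h => hy (Subtype.ext h)
  -- A nonzero polynomial cannot vanish on a product of infinite sets, so the parameters may be
  -- taken small. Small slopes later keep the hyperplane close to the given one.
  obtain ⟨c, hc, hcε⟩ : ∃ c : ℕ ⊕ ℕ × ℕ → ℂ, eval c (A.det : Poly) ≠ 0 ∧ ∀ v, ‖c v‖ < ε := by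
    by_contra hno
    push Not at hno
    apply h2
    refine MvPolynomial.funext_set (fun _ => Metric.ball (0 : ℂ) ε) (fun _ => ?_) fun x hx => ?_
    · exact infinite_of_mem_nhds 0 (Metric.ball_mem_nhds 0 hε)
    · rw [map_zero]
      by_contra hne
      obtain ⟨v, hv⟩ := hno x hne
      have := hx v trivial
      rw [mem_ball_zero_iff] at this
      exact absurd this (not_lt.2 hv)
  refine ⟨J, fun k => c (Sum.inr (m, k)), c (Sum.inr (m, m)), fun i k => y i k,
    fun i => hcε _, ?_⟩
  have h3 : eval c (A.det : Poly) = ((eval c).comp (ParamRing 0).val.toRingHom) A.det := rfl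
  rw [h3, RingHom.map_det] at hc
  convert hc using 2
  ext i l
  have h4 : ((eval c).comp (ParamRing 0).val.toRingHom).mapMatrix A i l =
      eval c (evalCoord (y i) (restr m (embed (m + 1) (P (J l))))) := rfl
  rw [h4, eval_evalCoord, eval_restr, embed, eval_rename, Matrix.of_apply]
  congr 2
  ext k
  refine Fin.lastCases ?_ (fun k => ?_) k
  · rw [Fin.snoc_last, Function.comp_apply, Fin.val_last, Function.update_self,
      Finset.sum_range]
    rfl
  · have hk : (Sum.inl (k.castSucc : ℕ) : ℕ ⊕ ℕ × ℕ) ≠ Sum.inl m := fun h =>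
      k.2.ne (Sum.inl_injective h)
    rw [Fin.snoc_castSucc, Function.comp_apply, Function.update_of_ne hk]
    rfl

end GenericHyperplane

/-! ### Leading forms of analytic functions -/

section LeadingForms

open Filter Topology

/-- Vectors whose leading forms with respect to a separating sequence of homogeneous linear maps
are linearly independent. -/
theorem exists_linearIndependent_leading {n : ℕ} (d : ℕ) {V : Type} [AddCommGroup V] [Module ℂ V]
    [FiniteDimensional ℂ V] (c : ℕ → V →ₗ[ℂ] MvPolynomial (Fin n) ℂ)
    (hc : ∀ k v, (c k v).IsHomogeneous k) (hsep : ∀ v, (∀ k, c k v = 0) → v = 0)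
    (hd : d ≤ Module.finrank ℂ V) :
    ∃ (b : Fin d → V) (e : Fin d → ℕ), (∀ i, ∀ k < e i, c k (b i) = 0) ∧
      LinearIndependent ℂ fun i => c (e i) (b i) := by
  induction d generalizing V with
  | zero => exact ⟨Fin.elim0, Fin.elim0, fun i => i.elim0, linearIndependent_empty_type⟩
  | succ d ih =>
    classical
    have hex : ∃ k, ∃ v, c k v ≠ 0 := by
      by_contra hno
      push Not at hno
      have : Subsingleton V := ⟨fun x y => by
        rw [hsep x fun k => hno k x, hsep y fun k => hno k y]⟩
      rw [Module.finrank_zero_of_subsingleton] at hd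
      omega
    obtain ⟨k, ⟨w, hw⟩, hmin⟩ : ∃ k, (∃ v, c k v ≠ 0) ∧ ∀ l < k, ∀ v, c l v = 0 :=
      ⟨Nat.find hex, Nat.find_spec hex, fun l hl v => by
        by_contra h
        exact Nat.find_min hex hl ⟨v, h⟩⟩
    obtain ⟨μ, hμ⟩ := MvPolynomial.ne_zero_iff.1 hw
    -- `φ` reads off a monomial `μ` of the lowest leading form. Leading forms from its kernel lack
    -- `μ`: in degree `k` by definition, in other degrees by homogeneity. So `c k w` is not in their
    -- span.
    set φ : V →ₗ[ℂ] ℂ := (MvPolynomial.lcoeff ℂ μ).comp (c k) with hφ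
    have hker : d ≤ Module.finrank ℂ (LinearMap.ker φ) := by
      have h1 := φ.finrank_range_add_finrank_ker
      have h2 := (LinearMap.range φ).finrank_le
      rw [Module.finrank_self] at h2
      omega
    obtain ⟨b, e, hb, hli⟩ := ih (V := LinearMap.ker φ) (fun l => (c l).domRestrict _)
      (fun l v => hc l v) (fun v hv => Subtype.ext (hsep v hv)) hker
    refine ⟨Fin.cons w fun i => b i, Fin.cons k e, ?_, ?_⟩
    · intro i
      refine Fin.cases ?_ (fun i => ?_) i
      · exact fun l hl => hmin l hl _
      · exact fun l hl => hb i l hl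
    · have : (fun i => c ((Fin.cons k e : Fin (d + 1) → ℕ) i)
          ((Fin.cons w fun i => (b i : V) : Fin (d + 1) → V) i)) =
          Fin.cons (c k w) fun i => c (e i) (b i) := by
        ext1 i
        refine Fin.cases rfl (fun i => rfl) i
      rw [this, linearIndependent_finCons]
      refine ⟨hli, fun hmem => ?_⟩
      have h1 : Submodule.span ℂ (Set.range fun i => c (e i) (b i)) ≤
          LinearMap.ker (MvPolynomial.lcoeff ℂ μ) := by
        rw [Submodule.span_le]
        rintro _ ⟨i, rfl⟩
        rw [SetLike.mem_coe, LinearMap.mem_ker]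
        by_cases hek : e i = k
        · have := (b i).2
          rw [LinearMap.mem_ker] at this
          simp only [hek]
          exact this
        · refine (hc (e i) (b i)).coeff_eq_zero ?_
          intro h
          exact hek (h.symm.trans (by_contra fun h' => hμ ((hc k w).coeff_eq_zero h')))
      exact hμ (h1 hmem)

/-- The homogeneous polynomial given by a form of a formal multilinear series. -/
noncomputable def seriesPoly {n : ℕ} {E : Type} [NormedAddCommGroup E] [NormedSpace ℂ E]
    (p : FormalMultilinearSeries ℂ (Fin n → ℂ) E) (k : ℕ) :
    (E →ₗ[ℂ] ℂ) →ₗ[ℂ] MvPolynomial (Fin n) ℂ where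
  toFun μ := ∑ r : Fin k → Fin n, C (μ (p k fun j => Pi.single (r j) 1)) * ∏ j, X (r j)
  map_add' μ ν := by
    rw [← Finset.sum_add_distrib]
    refine Finset.sum_congr rfl fun r _ => ?_
    rw [LinearMap.add_apply, C_add, add_mul]
  map_smul' a μ := by
    rw [Finset.smul_sum]
    refine Finset.sum_congr rfl fun r _ => ?_
    rw [LinearMap.smul_apply, smul_eq_mul, C_mul, mul_assoc, smul_eq_C_mul, RingHom.id_apply]

theorem seriesPoly_isHomogeneous {n : ℕ} {E : Type} [NormedAddCommGroup E] [NormedSpace ℂ E]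
    (p : FormalMultilinearSeries ℂ (Fin n → ℂ) E) (k : ℕ) (μ : E →ₗ[ℂ] ℂ) :
    (seriesPoly p k μ).IsHomogeneous k := by
  refine IsHomogeneous.sum _ _ _ fun r _ => ?_
  have h1 : (∏ j : Fin k, (X (r j) : MvPolynomial (Fin n) ℂ)).IsHomogeneous (∑ j : Fin k, 1) :=
    IsHomogeneous.prod _ _ _ fun j _ => isHomogeneous_X ℂ (r j)
  simpa using (isHomogeneous_C (Fin n) (μ (p k fun j => Pi.single (r j) 1))).mul h1

theorem eval_seriesPoly {n : ℕ} {E : Type} [NormedAddCommGroup E] [NormedSpace ℂ E]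
    (p : FormalMultilinearSeries ℂ (Fin n → ℂ) E) (k : ℕ) (μ : E →ₗ[ℂ] ℂ) (y : Fin n → ℂ) :
    eval y (seriesPoly p k μ) = μ (p k fun _ => y) := by
  classical
  have hy : (fun _ : Fin k => y) = fun _ => ∑ i : Fin n, y i • (Pi.single i 1 : Fin n → ℂ) := by
    ext1
    exact pi_eq_sum_univ' y
  rw [hy, ContinuousMultilinearMap.map_sum, map_sum]
  simp only [seriesPoly, LinearMap.coe_mk, AddHom.coe_mk, map_sum, map_mul, eval_C, map_prod, eval_X]
  refine Finset.sum_congr rfl fun r _ => ?_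
  rw [ContinuousMultilinearMap.map_smul_univ, map_smul, smul_eq_mul, mul_comm]

/-- The Taylor remainder beyond degree `d` is `O(|ε|^(d+1))`, so after division by `ε^d` only the
degree `d` form survives. -/
theorem tendsto_leadingForm {n : ℕ} {E : Type} [NormedAddCommGroup E] [NormedSpace ℂ E]
    [FiniteDimensional ℂ E] {G : (Fin n → ℂ) → E} {p : FormalMultilinearSeries ℂ (Fin n → ℂ) E}
    (hp : HasFPowerSeriesAt G p 0) {μ : E →ₗ[ℂ] ℂ} {d : ℕ}
    (hd : ∀ k < d, seriesPoly p k μ = 0) (y : Fin n → ℂ) :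
    Tendsto (fun ε : ℂ => (ε ^ d)⁻¹ * μ (G (ε • y))) (𝓝[≠] 0)
      (𝓝 (eval y (seriesPoly p d μ))) := by
  have h1 := hp.isBigO_sub_partialSum_pow (d + 1)
  have h2 : Tendsto (fun ε : ℂ => ε • y) (𝓝 0) (𝓝 0) := by
    have : Continuous fun ε : ℂ => ε • y := by fun_prop
    simpa using this.tendsto 0
  have h3 := ((LinearMap.toContinuousLinearMap μ).isBigO_comp _ _).trans (h1.comp_tendsto h2)
  have h4 : (fun ε : ℂ => μ (G (ε • y)) - ε ^ d * eval y (seriesPoly p d μ)) =O[𝓝 0]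
      fun ε : ℂ => ‖ε‖ ^ (d + 1) := by
    refine (h3.congr_left fun ε => ?_).trans ?_
    · simp only [Function.comp_apply, zero_add, map_sub, LinearMap.coe_toContinuousLinearMap',
        FormalMultilinearSeries.partialSum, map_sum]
      congr 1
      rw [Finset.sum_range_succ, Finset.sum_eq_zero, zero_add, eval_seriesPoly]
      · rw [ContinuousMultilinearMap.map_smul_univ (p d) (fun _ => ε) fun _ => y]
        simp
      · intro k hk
        rw [← eval_seriesPoly, hd k (Finset.mem_range.1 hk), map_zero]
    · refine Asymptotics.IsBigO.of_bound (‖y‖ ^ (d + 1)) (Eventually.of_forall fun ε => ?_)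
      simp only [Function.comp_apply, norm_smul, norm_pow, norm_mul, norm_norm]
      rw [mul_pow, mul_comm]
  rw [tendsto_iff_norm_sub_tendsto_zero]
  obtain ⟨K, hK⟩ := h4.bound
  refine squeeze_zero' (Eventually.of_forall fun _ => norm_nonneg _)
    (g := fun ε : ℂ => K * ‖ε‖) ?_ ?_
  · filter_upwards [nhdsWithin_le_nhds hK, self_mem_nhdsWithin] with ε hε hne
    have hne : ε ≠ 0 := hne
    have hpos : 0 < ‖ε‖ ^ d := pow_pos (norm_pos_iff.2 hne) d
    have h5 : (ε ^ d)⁻¹ * μ (G (ε • y)) - eval y (seriesPoly p d μ) =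
        (ε ^ d)⁻¹ * (μ (G (ε • y)) - ε ^ d * eval y (seriesPoly p d μ)) := by
      rw [mul_sub, inv_mul_cancel_left₀ (pow_ne_zero d hne)]
    rw [h5, norm_mul, norm_inv, norm_pow, inv_mul_le_iff₀ hpos]
    refine hε.trans (le_of_eq ?_)
    rw [norm_pow, norm_norm]
    ring
  · have : Continuous fun ε : ℂ => K * ‖ε‖ := by fun_prop
    have := this.tendsto 0
    simp only [norm_zero, mul_zero] at this
    exact this.mono_left nhdsWithin_le_nhds

/-- A space of analytic functions contains functions with linearly independent leading forms,
to the number of its dimension. -/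
theorem exists_leadingForms {n d : ℕ} {E V : Type} [NormedAddCommGroup E] [NormedSpace ℂ E]
    [FiniteDimensional ℂ E] [AddCommGroup V] [Module ℂ V] [FiniteDimensional ℂ V]
    {G : (Fin n → ℂ) → E} (hG : AnalyticAt ℂ G 0) (Φ : V →ₗ[ℂ] E →ₗ[ℂ] ℂ)
    (hΦ : ∀ v, (∀ᶠ y in 𝓝 0, Φ v (G y) = 0) → v = 0) (hd : d ≤ Module.finrank ℂ V) :
    ∃ (b : Fin d → V) (e : Fin d → ℕ) (P : Fin d → MvPolynomial (Fin n) ℂ),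
      LinearIndependent ℂ P ∧ ∀ i y, Tendsto (fun ε : ℂ => (ε ^ e i)⁻¹ * Φ (b i) (G (ε • y)))
        (𝓝[≠] 0) (𝓝 (eval y (P i))) := by
  obtain ⟨p, hp⟩ := hG
  have hsep : ∀ v, (∀ k, ((seriesPoly p k).comp Φ) v = 0) → v = 0 := by
    intro v hv
    apply hΦ
    filter_upwards [hp.eventually_hasSum] with y hy
    rw [zero_add] at hy
    have h1 := hy.mapL (LinearMap.toContinuousLinearMap (Φ v))
    have h2 : (fun k => (LinearMap.toContinuousLinearMap (Φ v)) (p k fun _ => y)) = fun _ => 0 := by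
      ext1 k
      rw [LinearMap.coe_toContinuousLinearMap', ← eval_seriesPoly]
      have := hv k
      rw [LinearMap.comp_apply] at this
      rw [this, map_zero]
    rw [h2] at h1
    exact h1.unique hasSum_zero
  obtain ⟨b, e, hb, hli⟩ := exists_linearIndependent_leading d
    (fun k => (seriesPoly p k).comp Φ) (fun k v => seriesPoly_isHomogeneous p k _) hsep hd
  exact ⟨b, e, _, hli, fun i y => tendsto_leadingForm hp (hb i) y⟩

end LeadingForms

/-! ### Topology of projective space and the identity theorem -/

section ProjectiveSpace

open Filter Topology

theorem CPn.continuous_mk (n : ℕ) :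
    Continuous fun w : {w : Fin (n + 1) → ℂ // w ≠ 0} => (Projectivization.mk ℂ w.1 w.2 : CPn n) :=
  continuous_quotient_mk'

/-- The cone over an open set is open. -/
theorem CPn.isOpen_cone {n : ℕ} {U : Set (CPn n)} (hU : IsOpen U) :
    IsOpen {w : Fin (n + 1) → ℂ | ∃ hw : w ≠ 0, Projectivization.mk ℂ w hw ∈ U} := by
  have h1 := isOpen_ne.isOpenMap_subtype_val _ (hU.preimage (CPn.continuous_mk n))
  convert h1 using 1
  ext w
  constructor
  · rintro ⟨hw, h⟩
    exact ⟨⟨w, hw⟩, h, rfl⟩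
  · rintro ⟨⟨w, hw⟩, h, rfl⟩
    exact ⟨hw, h⟩

/-- The image of an open set in projective space is open. -/
theorem CPn.isOpen_image {n : ℕ} {O : Set (Fin (n + 1) → ℂ)} (hO : IsOpen O) :
    IsOpen {x : CPn n | ∃ w ∈ O, ∃ hw : w ≠ 0, Projectivization.mk ℂ w hw = x} := by
  change IsOpen ((fun w : {w : Fin (n + 1) → ℂ // w ≠ 0} =>
    (Projectivization.mk ℂ w.1 w.2 : CPn n)) ⁻¹' _)
  have h : IsOpen (⋃ a : ℂˣ, (fun w : {w : Fin (n + 1) → ℂ // w ≠ 0} => a • w.1) ⁻¹' O) :=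
    isOpen_iUnion fun a => hO.preimage (by fun_prop)
  convert h using 1
  ext ⟨w, hw⟩
  simp only [Set.mem_preimage, Set.mem_ofPred_eq, Set.mem_iUnion]
  constructor
  · rintro ⟨z, hz, hz0, h⟩
    obtain ⟨a, rfl⟩ := (Projectivization.mk_eq_mk_iff ℂ z w hz0 hw).1 h
    exact ⟨a, hz⟩
  · rintro ⟨a, ha⟩
    have h0 : a • w ≠ 0 := (smul_ne_zero_iff_ne a).2 hw
    exact ⟨a • w, ha, h0, (Projectivization.mk_eq_mk_iff ℂ _ _ h0 hw).2 ⟨a, rfl⟩⟩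

theorem rep_eq_zero_iff {M : ℕ} (μ : (Fin (M + 1) → ℂ) →ₗ[ℂ] ℂ) {w : Fin (M + 1) → ℂ} (hw : w ≠ 0) :
    μ (Projectivization.mk ℂ w hw).rep = 0 ↔ μ w = 0 := by
  obtain ⟨a, ha⟩ := Projectivization.exists_smul_eq_mk_rep ℂ w hw
  rw [← ha, Units.smul_def, map_smul, smul_eq_mul, mul_eq_zero, or_iff_right a.ne_zero]

/-- A linear form that vanishes on the values of a holomorphic map near a point of a connected
set vanishes on all values. -/
theorem IsHolomorphicOn.eq_zero_of_eventually {n M : ℕ} {U : Set (CPn n)} {f : CPn n → CPn M}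
    (hf : IsHolomorphicOn f U) (hU : IsPreconnected U) (μ : (Fin (M + 1) → ℂ) →ₗ[ℂ] ℂ)
    {x₀ : CPn n} (hx₀ : x₀ ∈ U) (h : {x | μ (f x).rep = 0} ∈ 𝓝 x₀) :
    ∀ x ∈ U, μ (f x).rep = 0 := by
  set Z : Set (CPn n) := {x | μ (f x).rep = 0} with hZ
  suffices hsub : U ⊆ interior Z from fun x hx => interior_subset (s := Z) (hsub hx)
  -- The interior of `Z` is relatively closed in `U`: around a limit point the lifted form is
  -- analytic on a ball and vanishes on an open part of it, hence on the whole ball.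
  refine hU.subset_of_closure_inter_subset isOpen_interior
    ⟨x₀, hx₀, mem_interior_iff_mem_nhds.2 h⟩ ?_
  rintro x ⟨hxc, hxU⟩
  induction x using Projectivization.ind with
  | h v hv =>
  obtain ⟨O, F, hO, hvO, hF, hfF⟩ := hf v hv hxU
  obtain ⟨ε, hε, hball⟩ := Metric.isOpen_iff.1 (hO.inter (isOpen_ne (x := (0 : Fin (n + 1) → ℂ))))
    v ⟨hvO, hv⟩
  set B := Metric.ball v ε with hB
  have hBo : IsOpen {x : CPn n | ∃ w ∈ B, ∃ hw : w ≠ 0, Projectivization.mk ℂ w hw = x} :=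
    CPn.isOpen_image Metric.isOpen_ball
  obtain ⟨_, ⟨w₁, hw₁, hw₁0, rfl⟩, hw₁Z⟩ :=
    mem_closure_iff.1 hxc _ hBo ⟨v, Metric.mem_ball_self hε, hv, rfl⟩
  have hval : ∀ w ∈ B, ∀ hw : w ≠ 0, (Projectivization.mk ℂ w hw ∈ Z ↔ μ (F w) = 0) := by
    intro w hw hw0
    obtain ⟨hFw, hfw⟩ := hfF w (hball hw).1 hw0
    rw [hZ, Set.mem_ofPred_eq, hfw, rep_eq_zero_iff]
  have han : AnalyticOnNhd ℂ (fun w => μ (F w)) B := fun w hw =>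
    ((LinearMap.toContinuousLinearMap μ).analyticAt _).comp (hF w (hball hw).1)
  have hev : (fun w => μ (F w)) =ᶠ[𝓝 w₁] 0 := by
    filter_upwards [(CPn.isOpen_cone (isOpen_interior (s := Z))).mem_nhds ⟨hw₁0, hw₁Z⟩,
      Metric.isOpen_ball.mem_nhds hw₁] with w hw hwB
    obtain ⟨hw0, hwZ⟩ := hw
    exact (hval w hwB hw0).1 (interior_subset hwZ)
  have hzero := han.eqOn_zero_of_preconnected_of_eventuallyEq_zero
    (convex_ball v ε).isPreconnected hw₁ hev
  refine mem_interior.2 ⟨_, ?_, hBo, v, Metric.mem_ball_self hε, hv, rfl⟩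
  rintro _ ⟨w, hw, hw0, rfl⟩
  exact (hval w hw hw0).2 (hzero hw)

theorem le_submodule_span {M : ℕ} {A : Set (CPn M)} {x : CPn M} (hx : x ∈ A) {w : Fin (M + 1) → ℂ}
    (hw : w ≠ 0) (h : Projectivization.mk ℂ w hw = x) :
    w ∈ Projectivization.Subspace.submodule (Projectivization.Subspace.span A) := by
  rw [Projectivization.Subspace.mem_submodule_iff _ hw, h]
  exact Projectivization.Subspace.subset_span A hx

/-- A linear form that vanishes on a set of points vanishes on its span. -/
theorem eq_zero_of_mem_submodule_span {M : ℕ} {A : Set (CPn M)} (μ : (Fin (M + 1) → ℂ) →ₗ[ℂ] ℂ)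
    (h : ∀ x ∈ A, μ x.rep = 0) {w : Fin (M + 1) → ℂ}
    (hw : w ∈ Projectivization.Subspace.submodule (Projectivization.Subspace.span A)) :
    μ w = 0 := by
  have h1 : Projectivization.Subspace.span A ≤ (LinearMap.ker μ).projectivization := by
    rw [Projectivization.Subspace.span_le_subspace_iff]
    intro x hx
    have h2 := h x hx
    rw [← Projectivization.mk_rep x]
    exact (Submodule.mk_mem_projectivization_iff _ x.rep_nonzero).2 h2
  have h3 := Projectivization.Subspace.submodule.monotone h1
  rw [OrderIso.apply_symm_apply] at h3
  exact h3 hw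

/-- Coordinates adapted to a point on a hyperplane. -/
theorem exists_frame {m : ℕ} {v z : Fin (m + 1 + 1) → ℂ} (hv : v ≠ 0) (hz : z ≠ 0)
    (hvz : v ⬝ᵥ z = 0) :
    ∃ (e ζ : Fin (m + 1 + 1) → ℂ) (u ω : Fin m → Fin (m + 1 + 1) → ℂ),
      v ⬝ᵥ e = 1 ∧ ζ ⬝ᵥ z = 1 ∧ ζ ⬝ᵥ e = 0 ∧ (∀ k, v ⬝ᵥ u k = 0) ∧ (∀ k, ζ ⬝ᵥ u k = 0) ∧
      (∀ k, ω k ⬝ᵥ z = 0) ∧ (∀ k, ω k ⬝ᵥ e = 0) ∧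
      (∀ k l, ω k ⬝ᵥ u l = if k = l then 1 else 0) ∧
      ∀ x, x = (ζ ⬝ᵥ x) • z + (∑ k, (ω k ⬝ᵥ x) • u k + (v ⬝ᵥ x) • e) := by
  classical
  have hdual : ∀ {x : Fin (m + 1 + 1) → ℂ}, x ≠ 0 → ∃ y, y ⬝ᵥ x = 1 := by
    intro x hx
    obtain ⟨i, hi⟩ := Function.ne_iff.1 hx
    exact ⟨Pi.single i (x i)⁻¹, by rw [single_dotProduct, inv_mul_cancel₀ hi]⟩
  obtain ⟨ζ, hζ⟩ := hdual hz
  obtain ⟨e', he'⟩ := hdual hv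
  rw [dotProduct_comm] at he'
  set e := e' - (ζ ⬝ᵥ e') • z with he
  have hve : v ⬝ᵥ e = 1 := by
    rw [he, dotProduct_sub, dotProduct_smul, hvz, smul_zero, sub_zero, he']
  have hζe : ζ ⬝ᵥ e = 0 := by
    rw [he, dotProduct_sub, dotProduct_smul, hζ, smul_eq_mul, mul_one, sub_self]
  set L : (Fin (m + 1 + 1) → ℂ) →ₗ[ℂ] ℂ × ℂ :=
    (dotProductBilin ℂ ℂ v).prod (dotProductBilin ℂ ℂ ζ) with hL
  have hLa : ∀ x, L x = (v ⬝ᵥ x, ζ ⬝ᵥ x) := fun _ => rfl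
  have hsurj : LinearMap.range L = ⊤ := by
    rw [LinearMap.range_eq_top]
    rintro ⟨a, b⟩
    refine ⟨a • e + b • z, ?_⟩
    rw [hLa]
    simp [dotProduct_add, dotProduct_smul, hve, hζe, hvz, hζ]
  have hdim : Module.finrank ℂ (LinearMap.ker L) = m := by
    have := L.finrank_range_add_finrank_ker
    rw [hsurj, finrank_top, Module.finrank_prod, Module.finrank_self, Module.finrank_fin_fun] at this
    omega
  set b := Module.finBasisOfFinrankEq ℂ (LinearMap.ker L) hdim with hb
  set R : (Fin (m + 1 + 1) → ℂ) →ₗ[ℂ] LinearMap.ker L :=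
    LinearMap.codRestrict (LinearMap.ker L)
      (LinearMap.id - (dotProductBilin ℂ ℂ ζ).smulRight z - (dotProductBilin ℂ ℂ v).smulRight e)
      (by
        intro x
        rw [LinearMap.mem_ker, hLa]
        simp [dotProduct_sub, dotProduct_smul, hve, hζe, hvz, hζ]) with hR
  have hRa : ∀ x, (R x : Fin (m + 1 + 1) → ℂ) = x - (ζ ⬝ᵥ x) • z - (v ⬝ᵥ x) • e := fun _ => rfl
  -- Coordinate functionals of the basis `b` after projection along `z` and `e`; thus `ζ`, `ω`, `v`
  -- are dual to `z`, `u`, `e`.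
  set ω : Fin m → Fin (m + 1 + 1) → ℂ := fun k => fun i => b.repr (R (Pi.single i 1)) k with hω
  have hωa : ∀ k x, ω k ⬝ᵥ x = b.repr (R x) k := by
    intro k x
    conv_rhs => rw [pi_eq_sum_univ' x]
    simp only [dotProduct, hω, map_sum, map_smul, Finsupp.coe_finsetSum, Finset.sum_apply,
      Finsupp.smul_apply, smul_eq_mul]
    exact Finset.sum_congr rfl fun i _ => mul_comm _ _
  have hbk : ∀ k, v ⬝ᵥ (b k : Fin (m + 1 + 1) → ℂ) = 0 ∧ ζ ⬝ᵥ (b k : Fin (m + 1 + 1) → ℂ) = 0 := by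
    intro k
    have := (b k).2
    rw [LinearMap.mem_ker, hLa, Prod.mk_eq_zero] at this
    exact this
  refine ⟨e, ζ, fun k => b k, ω, hve, hζ, hζe, fun k => (hbk k).1, fun k => (hbk k).2, ?_, ?_, ?_, ?_⟩
  · intro k
    have : R z = 0 := Subtype.ext (by rw [hRa, hζ, hvz]; simp)
    rw [hωa, this, map_zero, Finsupp.zero_apply]
  · intro k
    have : R e = 0 := Subtype.ext (by rw [hRa, hζe, hve]; simp)
    rw [hωa, this, map_zero, Finsupp.zero_apply]
  · intro k l
    have : R (b l) = b l := Subtype.ext (by rw [hRa, (hbk l).1, (hbk l).2]; simp)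
    rw [hωa, this, b.repr_self, Finsupp.single_apply]
    simp only [eq_comm]
  · intro x
    have h1 : ∑ k, (ω k ⬝ᵥ x) • (b k : Fin (m + 1 + 1) → ℂ) = R x := by
      simp only [hωa]
      have h2 := congrArg Subtype.val (b.sum_repr (R x))
      rw [← h2, Submodule.coe_sum]
      rfl
    rw [h1, hRa]
    abel

end ProjectiveSpace

/-! ### Affine charts and rescaling at a point of the hyperplane -/

section GeneralHyperplane

open Filter Topology

/-- The linear map with given values at the standard basis, the last one being separate. -/
noncomputable def frameMap {m : ℕ} (u : Fin m → Fin (m + 1 + 1) → ℂ) (e : Fin (m + 1 + 1) → ℂ) :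
    (Fin (m + 1) → ℂ) →ₗ[ℂ] Fin (m + 1 + 1) → ℂ :=
  ∑ k : Fin m, (LinearMap.proj k.castSucc : (Fin (m + 1) → ℂ) →ₗ[ℂ] ℂ).smulRight (u k) +
    (LinearMap.proj (Fin.last m) : (Fin (m + 1) → ℂ) →ₗ[ℂ] ℂ).smulRight e

theorem frameMap_apply {m : ℕ} (u : Fin m → Fin (m + 1 + 1) → ℂ) (e : Fin (m + 1 + 1) → ℂ)
    (y : Fin (m + 1) → ℂ) :
    frameMap u e y = ∑ k : Fin m, y k.castSucc • u k + y (Fin.last m) • e := by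
  simp [frameMap]

theorem analyticAt_frameMap {m : ℕ} (u : Fin m → Fin (m + 1 + 1) → ℂ) (e : Fin (m + 1 + 1) → ℂ)
    (z : Fin (m + 1 + 1) → ℂ) (y : Fin (m + 1) → ℂ) :
    AnalyticAt ℂ (fun y => z + frameMap u e y) y :=
  analyticAt_const.add ((LinearMap.toContinuousLinearMap (frameMap u e)).analyticAt y)

theorem continuous_dotProduct_left {k : ℕ} (a : Fin k → ℂ) : Continuous fun x => a ⬝ᵥ x :=
  continuous_const.dotProduct continuous_id

/-- If a linear form vanishes on the values of a holomorphic map in an affine chart near a point,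
it vanishes on the values near this point of projective space. -/
theorem mem_nhds_of_eventually_chart {m M : ℕ} {f : CPn (m + 1) → CPn M}
    {O : Set (Fin (m + 1 + 1) → ℂ)} {F : (Fin (m + 1 + 1) → ℂ) → Fin (M + 1) → ℂ} (hO : IsOpen O)
    (hfF : ∀ w ∈ O, ∀ hw : w ≠ 0, ∃ hF : F w ≠ 0,
      f (Projectivization.mk ℂ w hw) = Projectivization.mk ℂ (F w) hF)
    {v z e ζ : Fin (m + 1 + 1) → ℂ} {u ω : Fin m → Fin (m + 1 + 1) → ℂ} (hz : z ≠ 0) (hzO : z ∈ O)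
    (hvz : v ⬝ᵥ z = 0) (hζz : ζ ⬝ᵥ z = 1) (hωz : ∀ k, ω k ⬝ᵥ z = 0)
    (hdec : ∀ x, x = (ζ ⬝ᵥ x) • z + (∑ k, (ω k ⬝ᵥ x) • u k + (v ⬝ᵥ x) • e))
    (μ : (Fin (M + 1) → ℂ) →ₗ[ℂ] ℂ) (h : ∀ᶠ y in 𝓝 0, μ (F (z + frameMap u e y)) = 0) :
    {x | μ (f x).rep = 0} ∈ 𝓝 (Projectivization.mk ℂ z hz) := by
  -- The inverse chart: normalize to `ζ ⬝ᵥ w = 1` and read off the other coordinates.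
  set κ : (Fin (m + 1 + 1) → ℂ) → Fin (m + 1) → ℂ := fun w =>
    (ζ ⬝ᵥ w)⁻¹ • Fin.snoc (fun k => ω k ⬝ᵥ w) (v ⬝ᵥ w) with hκ
  have hκz : κ z = 0 := by
    ext k
    refine Fin.lastCases ?_ (fun k => ?_) k <;> simp [hκ, hvz, hωz]
  have hsnoc : Continuous fun w =>
      (Fin.snoc (fun k => ω k ⬝ᵥ w) (v ⬝ᵥ w) : Fin (m + 1) → ℂ) := by
    refine continuous_pi fun k => ?_
    refine Fin.lastCases ?_ (fun k => ?_) k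
    · simpa using continuous_dotProduct_left v
    · simpa using continuous_dotProduct_left (ω k)
  have hκc : Tendsto κ (𝓝 z) (𝓝 0) := by
    rw [← hκz]
    have hinv : ContinuousAt (fun w => (ζ ⬝ᵥ w)⁻¹) z :=
      (continuous_dotProduct_left ζ).continuousAt.inv₀ (by simp [hζz])
    exact hinv.smul hsnoc.continuousAt
  have hχc : Tendsto (fun y => z + frameMap u e y) (𝓝 0) (𝓝 z) := by
    have := (analyticAt_frameMap u e z 0).continuousAt.tendsto
    simpa using this
  have hζc : ∀ᶠ w in 𝓝 z, ζ ⬝ᵥ w ≠ 0 :=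
    (continuous_dotProduct_left ζ).continuousAt.eventually_ne (by rw [hζz]; exact one_ne_zero)
  have hev : ∀ᶠ w in 𝓝 z, ζ ⬝ᵥ w ≠ 0 ∧ z + frameMap u e (κ w) ∈ O ∧
      μ (F (z + frameMap u e (κ w))) = 0 :=
    hζc.and (((hχc.comp hκc).eventually (hO.mem_nhds hzO)).and (hκc.eventually h))
  obtain ⟨O', hO', hO'o, hzO'⟩ := mem_nhds_iff.1 hev
  refine mem_nhds_iff.2 ⟨_, ?_, CPn.isOpen_image hO'o, z, hzO', hz, rfl⟩
  rintro _ ⟨w, hw, hw0, rfl⟩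
  obtain ⟨h1, h2, h3⟩ := hO' hw
  have h4 : (ζ ⬝ᵥ w)⁻¹ • w = z + frameMap u e (κ w) := by
    refine (congrArg (fun x => (ζ ⬝ᵥ w)⁻¹ • x) (hdec w)).trans ?_
    rw [smul_add, smul_smul, inv_mul_cancel₀ h1, one_smul, frameMap_apply]
    congr 1
    simp [hκ, smul_add, Finset.smul_sum, smul_smul]
  have h5 : z + frameMap u e (κ w) ≠ 0 := by
    rw [← h4]
    exact smul_ne_zero (inv_ne_zero h1) hw0
  have h6 : Projectivization.mk ℂ w hw0 = Projectivization.mk ℂ _ h5 := by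
    rw [Projectivization.mk_eq_mk_iff']
    exact ⟨ζ ⬝ᵥ w, by rw [← h4, smul_smul, mul_inv_cancel₀ h1, one_smul]⟩
  obtain ⟨hF, hf⟩ := hfF _ h2 h5
  rw [Set.mem_ofPred_eq, h6, hf, rep_eq_zero_iff]
  exact h3

/-- A nonzero determinant of values of linear forms at points of a set bounds the dimension of
the span from below. -/
theorem le_projDim_of_det_ne_zero {M r : ℕ} {A : Set (CPn M)} {w : Fin (r + 1) → Fin (M + 1) → ℂ}
    (hw : ∀ i, ∃ h : w i ≠ 0, Projectivization.mk ℂ (w i) h ∈ A)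
    {μ : Fin (r + 1) → (Fin (M + 1) → ℂ) →ₗ[ℂ] ℂ}
    (hdet : (Matrix.of fun i l => μ l (w i)).det ≠ 0) :
    (r : ℤ) ≤ projDim (Projectivization.Subspace.span A) := by
  have h1 : LinearIndependent ℂ w :=
    LinearIndependent.of_comp (LinearMap.pi μ) (Matrix.linearIndependent_rows_of_det_ne_zero hdet)
  have h2 : ∀ i, w i ∈ Projectivization.Subspace.submodule (Projectivization.Subspace.span A) := by
    intro i
    obtain ⟨h, hA⟩ := hw i
    exact le_submodule_span hA h rfl
  have h3 : LinearIndependent ℂ fun i => (⟨w i, h2 i⟩ :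
      Projectivization.Subspace.submodule (Projectivization.Subspace.span A)) :=
    LinearIndependent.of_comp (Submodule.subtype _) h1
  have h4 := h3.fintype_card_le_finrank
  rw [Fintype.card_fin] at h4
  rw [projDim]
  omega

/-- Linear forms separating the values of a holomorphic map on general hyperplanes near a given
hyperplane, at points near a given point. -/
theorem exists_det_ne_zero_near {m M N δ : ℕ} {a : ℕ → ℕ} (ha : IsMacaulayRep (m + 1) N δ a)
    {U : Set (CPn (m + 1))} (hUc : IsPreconnected U) {f : CPn (m + 1) → CPn M}
    (hf : IsHolomorphicOn f U)
    (hspan : (N : ℤ) ≤ projDim (Projectivization.Subspace.span (f '' U)))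
    {O : Set (Fin (m + 1 + 1) → ℂ)} {F : (Fin (m + 1 + 1) → ℂ) → Fin (M + 1) → ℂ} (hO : IsOpen O)
    (hF : AnalyticOnNhd ℂ F O)
    (hfF : ∀ w ∈ O, ∀ hw : w ≠ 0, ∃ hF : F w ≠ 0,
      f (Projectivization.mk ℂ w hw) = Projectivization.mk ℂ (F w) hF)
    {v z : Fin (m + 1 + 1) → ℂ} (hv : v ≠ 0) (hz : z ≠ 0) (hvz : v ⬝ᵥ z = 0) (hzO : z ∈ O)
    (hzU : Projectivization.mk ℂ z hz ∈ U) {A B : Set (Fin (m + 1 + 1) → ℂ)}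
    (hA : A ∈ 𝓝 v) (hB : B ∈ 𝓝 z) :
    ∃ (h : Fin (m + 1 + 1) → ℂ) (x : Fin (macaulayMinus (m + 1) N + 1) → Fin (m + 1 + 1) → ℂ)
      (μ : Fin (macaulayMinus (m + 1) N + 1) → (Fin (M + 1) → ℂ) →ₗ[ℂ] ℂ),
      h ∈ A ∧ (∀ i, x i ∈ B ∧ h ⬝ᵥ x i = 0) ∧ (Matrix.of fun i l => μ l (F (x i))).det ≠ 0 := by
  obtain ⟨e, ζ, u, ω, hve, hζz, hζe, hvu, hζu, hωz, hωe, hωu, hdec⟩ := exists_frame hv hz hvz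
  set L := Projectivization.Subspace.submodule (Projectivization.Subspace.span (f '' U)) with hL
  have hdim : N + 1 ≤ Module.finrank ℂ (Module.Dual ℂ L) := by
    have h0 : (N : ℤ) ≤ (Module.finrank ℂ L : ℤ) - 1 := hspan
    have h1 : N + 1 ≤ Module.finrank ℂ L := by omega
    exact h1.trans_eq Subspace.dual_finrank_eq.symm
  obtain ⟨π, hπ⟩ := L.subtype.exists_leftInverse_of_injective (Submodule.ker_subtype L)
  have hπa : ∀ w : L, π w = w := fun w => DFunLike.congr_fun hπ w
  set Φ : Module.Dual ℂ L →ₗ[ℂ] (Fin (M + 1) → ℂ) →ₗ[ℂ] ℂ := LinearMap.lcomp ℂ ℂ π with hΦ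
  have hG : AnalyticAt ℂ (fun y => F (z + frameMap u e y)) 0 := by
    refine AnalyticAt.fun_comp ?_ (analyticAt_frameMap u e z 0)
    rw [map_zero, add_zero]
    exact hF z hzO
  -- Vanishing near `z` spreads over the connected set `U`, hence to the span `L`, where `Φ μ`
  -- agrees with `μ`.
  have hsep : ∀ μ, (∀ᶠ y in 𝓝 0, Φ μ (F (z + frameMap u e y)) = 0) → μ = 0 := by
    intro μ hμ
    have h1 := mem_nhds_of_eventually_chart hO hfF hz hzO hvz hζz hωz hdec (Φ μ) hμ
    have h2 := hf.eq_zero_of_eventually hUc (Φ μ) hzU h1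
    ext w
    have h3 := eq_zero_of_mem_submodule_span (A := f '' U) (Φ μ)
      (by rintro _ ⟨x, hx, rfl⟩; exact h2 x hx) w.2
    rw [hΦ, LinearMap.lcomp_apply, hπa] at h3
    exact h3
  obtain ⟨b, d, P, hP, hlim⟩ := exists_leadingForms hG Φ hsep hdim
  have hAt : Tendsto (fun t : Fin m → ℂ => v - ∑ k, t k • ω k) (𝓝 0) (𝓝 v) := by
    have : Continuous fun t : Fin m → ℂ => v - ∑ k, t k • ω k := by fun_prop
    simpa using this.tendsto 0
  obtain ⟨A', hA'A, hA'o, hvA'⟩ := mem_nhds_iff.1 hA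
  obtain ⟨ρ, hρ, hρA⟩ := Metric.eventually_nhds_iff_ball.1 (hAt.eventually (hA'o.mem_nhds hvA'))
  obtain ⟨J, t, s, y, ht, hdet⟩ := GenericHyperplane.exists_det_eval_ne_zero ha hP hρ
  have htA : v - ∑ k, t k • ω k ∈ A' := by
    apply hρA
    rw [mem_ball_zero_iff, pi_norm_lt_iff hρ]
    exact ht
  set Y : Fin (macaulayMinus (m + 1) N + 1) → Fin (m + 1) → ℂ := fun i =>
    Fin.snoc (y i) (∑ k, t k * y i k + s) with hY
  -- At the chart point `ε • Y` this hyperplane equation has the value `ε * (Y_m - ∑ t_k Y_k - s)`.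
  -- Only the slopes `t` must be small in advance, because the offset `s` is multiplied by `ε`.
  have h1 : ∀ᶠ ε : ℂ in 𝓝[≠] 0, v - ∑ k, t k • ω k - (ε * s) • ζ ∈ A := by
    have hc : Continuous fun ε : ℂ => v - ∑ k, t k • ω k - (ε * s) • ζ := by fun_prop
    have := hc.tendsto 0
    rw [zero_mul, zero_smul, sub_zero] at this
    exact nhdsWithin_le_nhds (this.eventually (mem_of_superset (hA'o.mem_nhds htA) hA'A))
  have h2 : ∀ᶠ ε : ℂ in 𝓝[≠] 0, ∀ i, z + frameMap u e (ε • Y i) ∈ B := by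
    refine eventually_all.2 fun i => nhdsWithin_le_nhds ?_
    have hc : Continuous fun ε : ℂ => z + frameMap u e (ε • Y i) := by
      have : Continuous (frameMap u e) := LinearMap.continuous_of_finiteDimensional _
      fun_prop
    have := hc.tendsto 0
    rw [zero_smul, map_zero, add_zero] at this
    exact this.eventually hB
  have h3 : ∀ᶠ ε : ℂ in 𝓝[≠] 0, (Matrix.of fun i l => (ε ^ d (J l))⁻¹ *
      Φ (b (J l)) (F (z + frameMap u e (ε • Y i)))).det ≠ 0 := by
    have hc : Tendsto (fun ε : ℂ => (Matrix.of fun i l => (ε ^ d (J l))⁻¹ *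
        Φ (b (J l)) (F (z + frameMap u e (ε • Y i)))).det) (𝓝[≠] 0)
        (𝓝 (Matrix.of fun i l => eval (Y i) (P (J l))).det) := by
      refine ((continuous_id.matrix_det).tendsto _).comp ?_
      exact tendsto_pi_nhds.2 fun i => tendsto_pi_nhds.2 fun l => hlim (J l) (Y i)
    exact hc.eventually_ne hdet
  obtain ⟨ε, hε1, hε2, hε3⟩ := (h1.and (h2.and h3)).exists
  refine ⟨_, fun i => z + frameMap u e (ε • Y i), fun l => Φ (b (J l)), hε1,
    fun i => ⟨hε2 i, ?_⟩, fun hzero => hε3 ?_⟩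
  · have hω : ∀ k, ω k ⬝ᵥ (z + frameMap u e (ε • Y i)) = ε * y i k := by
      intro k
      simp [frameMap_apply, dotProduct_add, dotProduct_sum, dotProduct_smul, hωz, hωe, hωu, hY]
    have hv' : v ⬝ᵥ (z + frameMap u e (ε • Y i)) = ε * (∑ k, t k * y i k + s) := by
      simp [frameMap_apply, dotProduct_add, dotProduct_sum, dotProduct_smul, hvz, hve, hvu, hY]
    have hζ' : ζ ⬝ᵥ (z + frameMap u e (ε • Y i)) = 1 := by
      simp [frameMap_apply, dotProduct_add, dotProduct_sum, dotProduct_smul, hζz, hζe, hζu]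
    rw [sub_dotProduct, sub_dotProduct, sum_dotProduct, smul_dotProduct, hv', hζ']
    simp only [smul_dotProduct, hω, smul_eq_mul]
    rw [mul_add, Finset.mul_sum]
    have : ∀ k, ε * (t k * y i k) = t k * (ε * y i k) := fun k => by ring
    simp only [this]
    ring
  · have := Matrix.det_mul_row (fun l => (ε ^ d (J l))⁻¹)
      (Matrix.of fun i l => Φ (b (J l)) (F (z + frameMap u e (ε • Y i))))
    rw [hzero, mul_zero] at this
    exact this

theorem analyticAt_det {E : Type} [NormedAddCommGroup E] [NormedSpace ℂ E] {r : ℕ}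
    {A : E → Matrix (Fin r) (Fin r) ℂ} {x : E} (h : ∀ i j, AnalyticAt ℂ (fun y => A y i j) x) :
    AnalyticAt ℂ (fun y => (A y).det) x := by
  simp only [Matrix.det_apply']
  refine Finset.analyticAt_fun_sum _ fun σ _ => ?_
  exact analyticAt_const.mul (Finset.analyticAt_fun_prod _ fun i _ => h _ _)

end GeneralHyperplane

/-! ### The analytic function vanishing on the exceptional hyperplanes -/

open Filter Topology in
theorem theorem1p2 (n M N : ℕ) (hn : 1 ≤ n) (hN : 1 ≤ N) (hNM : N ≤ M)
    (U : Set (CPn n)) (hUo : IsOpen U) (hUc : IsConnected U)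
    (f : CPn n → CPn M) (hf : IsHolomorphicOn f U)
    (hspan : (N : ℤ) ≤ projDim (Projectivization.Subspace.span (f '' U))) :
    ForGeneralHyperplaneMeeting U fun H =>
      (macaulayMinus n N : ℤ) ≤ projDim (Projectivization.Subspace.span (f '' (H ∩ U))) := by
  obtain ⟨δ, a, ha⟩ := exists_isMacaulayRep hn hN
  obtain ⟨m, rfl⟩ : ∃ m, n = m + 1 := ⟨n - 1, by omega⟩
  intro v hv hD
  obtain ⟨x, hxv, hxU⟩ := hD
  induction x using Projectivization.ind with
  | h z hz =>
  have hvz : v ⬝ᵥ z = 0 := (Projectivization.orthogonal_mk hv hz).1 hxv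
  obtain ⟨O, F, hO, hzO, hF, hfF⟩ := hf z hz hxU
  obtain ⟨e, he⟩ : ∃ e, v ⬝ᵥ e ≠ 0 := by
    obtain ⟨i, hi⟩ := Function.ne_iff.1 hv
    exact ⟨Pi.single i 1, by rwa [dotProduct_single, mul_one]⟩
  -- Projection of a point along `e` onto the hyperplane `q.1`. It makes fixed sample points follow
  -- a varying hyperplane analytically, as long as `q.1 ⬝ᵥ e ≠ 0`.
  set Ψ : (Fin (m + 1 + 1) → ℂ) × (Fin (m + 1 + 1) → ℂ) → Fin (m + 1 + 1) → ℂ := fun q =>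
    q.2 - ((q.1 ⬝ᵥ q.2) / (q.1 ⬝ᵥ e)) • e with hΨ
  have hdot : Continuous fun q : (Fin (m + 1 + 1) → ℂ) × (Fin (m + 1 + 1) → ℂ) => q.1 ⬝ᵥ q.2 :=
    continuous_fst.dotProduct continuous_snd
  have hdote : Continuous fun q : (Fin (m + 1 + 1) → ℂ) × (Fin (m + 1 + 1) → ℂ) => q.1 ⬝ᵥ e :=
    continuous_fst.dotProduct continuous_const
  have hΨc : Tendsto Ψ (𝓝 (v, z)) (𝓝 z) := by
    have h1 : ContinuousAt Ψ (v, z) :=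
      continuousAt_snd.sub ((hdot.continuousAt.div hdote.continuousAt he).smul continuousAt_const)
    have h2 : Ψ (v, z) = z := by simp [hΨ, hvz]
    have h3 := h1.tendsto
    rwa [h2] at h3
  have hcone := (CPn.isOpen_cone hUo).mem_nhds (x := z) ⟨hz, hxU⟩
  have hev : ∀ᶠ q in 𝓝 (v, z), q.1 ⬝ᵥ e ≠ 0 ∧ Ψ q ∈ O ∧
      ∃ hw : Ψ q ≠ 0, Projectivization.mk ℂ (Ψ q) hw ∈ U :=
    (hdote.continuousAt.eventually_ne he).and
      ((hΨc.eventually (hO.mem_nhds hzO)).and (hΨc.eventually hcone))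
  obtain ⟨A, hA, B, hB, hAB⟩ := mem_nhds_prod_iff.1 hev
  obtain ⟨ρ, hρ, hρA⟩ := Metric.mem_nhds_iff.1 hA
  obtain ⟨h₁, x, μ, hh₁, hx, hdet⟩ := exists_det_ne_zero_near ha hUc.isPreconnected hf hspan hO hF
    hfF hv hz hvz hzO hxU (Metric.ball_mem_nhds v hρ) hB
  have hmem : ∀ h ∈ Metric.ball v ρ, ∀ i, (h, x i) ∈ {q | q.1 ⬝ᵥ e ≠ 0 ∧ Ψ q ∈ O ∧
      ∃ hw : Ψ q ≠ 0, Projectivization.mk ℂ (Ψ q) hw ∈ U} :=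
    fun h hh i => hAB ⟨hρA hh, (hx i).1⟩
  refine ⟨Metric.ball v ρ, fun h => (Matrix.of fun i l => μ l (F (Ψ (h, x i)))).det,
    Metric.isOpen_ball, (convex_ball v ρ).isConnected (Metric.nonempty_ball.2 hρ),
    Metric.mem_ball_self hρ, ?_, ⟨h₁, hh₁, ?_⟩, ?_⟩
  · intro h hh
    refine analyticAt_det fun i l => ?_
    obtain ⟨hne, hΨO, -⟩ := hmem h hh i
    have hlin : ∀ w : Fin (m + 1 + 1) → ℂ, AnalyticAt ℂ (fun h => h ⬝ᵥ w) h := fun w =>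
      (LinearMap.toContinuousLinearMap ((dotProductBilin ℂ ℂ).flip w)).analyticAt h
    have hΨa : AnalyticAt ℂ (fun h => Ψ (h, x i)) h :=
      analyticAt_const.sub (((hlin (x i)).div (hlin e) hne).smul analyticAt_const)
    have hFa : AnalyticAt ℂ (fun h => F (Ψ (h, x i))) h :=
      AnalyticAt.fun_comp (g := F) (f := fun h => Ψ (h, x i)) (hF _ hΨO) hΨa
    exact AnalyticAt.fun_comp (g := μ l)
      ((LinearMap.toContinuousLinearMap (μ l)).analyticAt _) hFa
  -- The sample points already lie on `h₁`, so the determinant there is the one known to be nonzero.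
  · have : ∀ i, Ψ (h₁, x i) = x i := fun i => by simp [hΨ, (hx i).2]
    simp only [this]
    exact hdet
  · intro h hh hh0 hE
    by_contra hne
    refine hE.2 (le_projDim_of_det_ne_zero (fun i => ?_) hne)
    obtain ⟨hhe, hΨO, hΨ0, hΨU⟩ := hmem h hh i
    obtain ⟨hF0, hfΨ⟩ := hfF _ hΨO hΨ0
    refine ⟨hF0, _, ⟨?_, hΨU⟩, hfΨ⟩
    refine (Projectivization.orthogonal_mk hh0 hΨ0).2 ?_
    change h ⬝ᵥ (x i - ((h ⬝ᵥ x i) / (h ⬝ᵥ e)) • e) = 0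
    rw [dotProduct_sub, dotProduct_smul, smul_eq_mul, div_mul_cancel₀ _ hhe, sub_self]
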